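/- **Setup.** Let $\Omega\subset\mathbb R^d$ be a bounded open set (for instance a bounded Lipschitz domain), $T>0$, $\kappa\in\mathbb N_0$, $1\le\hat q\le\hat p<\infty$, $1<p<\infty$, $1\le q\le p$, $1\le r<\infty$. Let $V,\tilde V,W$ be reflexive separable real Banach spaces and $Y$ a real Banach space, with continuous embeddings $V\hookrightarrow\tilde V\hookrightarrow W$ and $L^{\hat q}(\Omega)\hookrightarrow W$, a compact embedding $V\hookrightarrow W^{\kappa,\hat p}(\Omega)$, and either $W^{\kappa,\hat p}(\Omega)\hookrightarrow\tilde V$ or $\tilde V\hookrightarrow W^{\kappa,\hat p}(\Omega)$. All these embeddings are compatible, i.e. they identify the same elements of $W$. Put $$\mathcal V=L^p(0,T;V)\cap W^{1,p,p}(0,T;\tilde V),\qquad \mathcal W=L^q(0,T;W),\qquad \mathcal Y=L^r(0,T;Y),$$ where $\mathcal V$ carries the norm $\|u\|_{\mathcal V}=\|u\|_{L^p(0,T;V)}+\|u\|_{L^p(0,T;\tilde V)}+\|\partial_tu\|_{L^p(0,T;\tilde V)}$, and let $\mathcal J_\kappa u=(D^\beta u)_{|\beta|\le\kappa}$ collect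 the weak spatial derivatives of $u$. Assume that there is $c_{\mathcal V}>0$ with $\|\mathcal J_\kappa u\|_{L^\infty((0,T)\times\Omega)}\le c_{\mathcal V}\|u\|_{\mathcal V}$ for all $u\in\mathcal V$. **Networks.** Fix a depth $L$, widths $n_0,\dots,n_L$ and $n^r_1,\dots,n^r_L$, where $n_0=1+\binom{d+\kappa}{\kappa}$ is the number of scalar variables $(t,(z_\beta)_{|\beta|\le\kappa})$, degrees $d_1,\dots,d_{L+1}$, continuous maps $\sigma_i:\mathbb R^{n^r_i}\to\mathbb R^{n_i}$ $(1\le i\le L)$, and $\varepsilon>0$. A parameter $\theta\in\Theta$ consists of the coefficients of rational maps $r_i:\mathbb R^{n_{i-1}}\to\mathbb R^{n^r_i}$ $(1\le i\le L)$ and $r_{L+1}:\mathbb R^{n_L+n_0}\to\mathbb R$. Each component of $r_i$ is a quotient of two polynomials of degree at most $d_i$; the numerator is arbitrary, and the denominator is at least $\varepsilon$ on the whole space and has a coefficient vector of Euclidean norm $1$. The network is $$\mathfrak S^\theta_\sigma(x)=r_{L+1}\big((\sigma_L\circ r_L\circ\dots\circ\sigma_1\circ r_1)(x),\,x\big),\qquad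 x\in\mathbb R^{n_0},$$ and it acts on $\mathcal J_\kappa u$, $u\in\mathcal V$, by $[\mathfrak S^\theta_\sigma(\mathcal J_\kappa u)](t)=\mathfrak S^\theta_\sigma(t,\mathcal J_\kappa u(t,\cdot))\in L^{\hat q}(\Omega)\hookrightarrow W$ for almost every $t\in(0,T)$. **Data and regularization.** For $m\in\mathbb N$ let $K^m:\mathcal V\to\mathcal Y$ be a (possibly nonlinear) map that is sequentially weak-weak continuous, and let $y^m\in\mathcal Y$, $\lambda^m,\mu^m>0$. Let $\mathcal R_0:\Theta\to[0,\infty]$ be proper (not identically $\infty$), coercive and lower semicontinuous, and let $\mathcal R(u,\theta)=\|u\|_{\mathcal V}^p+\mathcal R_0(\theta)$. **Claim.** For all $\theta\in\Theta$ and $u\in\mathcal V$ the element $\mathfrak S^\theta_\sigma(\mathcal J_\kappa u)$ of $\mathcal W$ is well defined, and for every $m\in\mathbb N$ the problem $$\min_{u\in\mathcal V,\ \theta\in\Theta}\ \lambda^m\|\partial_tu-\mathfrak S^\theta_\sigma(\mathcal J_\kappa u)\|_{\mathcal W}^q+\mu^m\|K^mu-y^m\|_{\mathcal Y}^r+\mathcal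 R(u,\theta)$$ has a minimizer $(u,\theta)\in\mathcal V\times\Theta$, and the minimum is finite. -/

import Mathlib

open MeasureTheory Filter Topology Set
open scoped ENNReal ContDiff

noncomputable section

/-! ### Symbolic networks -/

/-- Multi-indices `k = (k₁, …, kₙ)` with `k₁ + ⋯ + kₙ ≤ d`. -/
abbrev MultiIdx (n d : ℕ) : Type :=
  {k : Fin n → Fin (d + 1) // ∑ i, (k i : ℕ) ≤ d}

/-- The multi-index `(0, …, 0)`. -/
def MultiIdx.zero (n d : ℕ) : MultiIdx n d := ⟨fun _ => 0, by simp⟩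

/-- The polynomial function of degree at most `d` in `n` variables with coefficients `a`. -/
def polyEval {n d : ℕ} (a : MultiIdx n d → ℝ) (x : Fin n → ℝ) : ℝ :=
  ∑ k : MultiIdx n d, a k * ∏ l, x l ^ (k.1 l : ℕ)

/-- The set `Q̄^ε(d, n)` of coefficients, of Euclidean norm one, of polynomials bounded below
by `ε`. -/
def normalizedDenominators (ε : ℝ) (d n : ℕ) : Set (MultiIdx n d → ℝ) :=
  {b | (∀ x : Fin n → ℝ, ε ≤ polyEval b x) ∧ √(∑ k, b k ^ 2) = 1}

/-- Coefficients of the `m` numerators (first component) and of the `m` denominators (second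
component) of a rational map from `ℝⁿ` to `ℝᵐ` of degree at most `d`. -/
abbrev RatCoeff (n m d : ℕ) : Type :=
  (Fin m → MultiIdx n d → ℝ) × (Fin m → MultiIdx n d → ℝ)

/-- The rational map with given numerator and denominator coefficients. -/
def ratMap {n m d : ℕ} (c : RatCoeff n m d) (x : Fin n → ℝ) : Fin m → ℝ :=
  fun j => polyEval (c.1 j) x / polyEval (c.2 j) x

/-- A symbolic network architecture: depth, widths, degrees and (fixed) activation maps. -/
structure SymbolicArchitecture where
  /-- the number `L` of hidden layers -/
  depth : ℕ
  /-- the widths of the input (index `0`) and of the outputs of the activations -/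
  actWidth : Fin (depth + 1) → ℕ
  /-- the widths of the outputs of the hidden rational maps -/
  ratWidth : Fin depth → ℕ
  /-- the degrees of the hidden rational maps -/
  degree : Fin depth → ℕ
  /-- the degree of the rational map of the output layer -/
  outDegree : ℕ
  /-- the activation maps -/
  act : ∀ i : Fin depth, (Fin (ratWidth i) → ℝ) → (Fin (actWidth i.succ) → ℝ)

namespace SymbolicArchitecture

variable (A : SymbolicArchitecture)

/-- All coefficients of all the rational maps of the network (a finite-dimensional space). -/
abbrev Coeff : Type :=
  (∀ i : Fin A.depth, RatCoeff (A.actWidth i.castSucc) (A.ratWidth i) (A.degree i)) ×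
    RatCoeff (A.actWidth (Fin.last A.depth) + A.actWidth 0) 1 A.outDegree

/-- The parameter set `Θ`: numerators are arbitrary, denominators lie in `Q̄^ε`. -/
def paramSet (ε : ℝ) : Set A.Coeff :=
  {θ | (∀ i j, (θ.1 i).2 j ∈ normalizedDenominators ε (A.degree i) (A.actWidth i.castSucc)) ∧
    ∀ j, θ.2.2 j ∈
      normalizedDenominators ε A.outDegree (A.actWidth (Fin.last A.depth) + A.actWidth 0)}

variable {A}

/-- The output `(σᵢ ∘ rᵢ ∘ ⋯ ∘ σ₁ ∘ r₁)(x)` of the first `i` hidden layers. -/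
def hidden (θ : A.Coeff) (x : Fin (A.actWidth 0) → ℝ) (i : Fin (A.depth + 1)) :
    Fin (A.actWidth i) → ℝ :=
  Fin.induction (motive := fun i => Fin (A.actWidth i) → ℝ) x
    (fun i y => A.act i (ratMap (θ.1 i) y)) i

/-- The network `x ↦ r_{L+1}((σ_L ∘ r_L ∘ ⋯ ∘ σ₁ ∘ r₁)(x), x)`. -/
def eval (θ : A.Coeff) (x : Fin (A.actWidth 0) → ℝ) : ℝ :=
  ratMap θ.2 (Fin.append (hidden θ x (Fin.last A.depth)) x) 0

/-- The network as a function of time and of the values of all derivatives of order at most `κ`.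
The bijection `coord` enumerates these scalar variables; `none` stands for the time. -/
def law {d κ : ℕ} (coord : Fin (A.actWidth 0) ≃ Option (MultiIdx d κ)) (θ : A.Coeff)
    (t : ℝ) (z : MultiIdx d κ → ℝ) : ℝ :=
  eval θ fun j => (coord j).elim t z

end SymbolicArchitecture

/-! ### Sobolev spaces on a domain -/

/-- The partial derivative of `φ` in the direction of the `i`-th coordinate. -/
def partialD {d : ℕ} (i : Fin d) (φ : EuclideanSpace ℝ (Fin d) → ℝ) :
    EuclideanSpace ℝ (Fin d) → ℝ :=
  fun x => fderiv ℝ φ x (EuclideanSpace.single i 1)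

/-- The classical partial derivative `D^β φ = ∂₁^{β₁} ⋯ ∂_d^{β_d} φ`. -/
def multiD {d : ℕ} (β : Fin d → ℕ) (φ : EuclideanSpace ℝ (Fin d) → ℝ) :
    EuclideanSpace ℝ (Fin d) → ℝ :=
  (List.finRange d).foldr (fun i f => (partialD i)^[β i] f) φ

theorem partialD_smooth {d : ℕ} (i : Fin d) {φ : EuclideanSpace ℝ (Fin d) → ℝ}
    (h : ContDiff ℝ ∞ φ ∧ HasCompactSupport φ) :
    ContDiff ℝ ∞ (partialD i φ) ∧ HasCompactSupport (partialD i φ) :=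
  ⟨(h.1.fderiv_right (m := ∞) (by simp)).clm_apply contDiff_const, h.2.fderiv_apply ℝ _⟩

theorem multiD_smooth {d : ℕ} (β : Fin d → ℕ) {φ : EuclideanSpace ℝ (Fin d) → ℝ}
    (h : ContDiff ℝ ∞ φ ∧ HasCompactSupport φ) :
    ContDiff ℝ ∞ (multiD β φ) ∧ HasCompactSupport (multiD β φ) := by
  unfold multiD
  induction List.finRange d with
  | nil => simpa using h
  | cons i l ih =>
    simp only [List.foldr_cons]
    generalize β i = n
    induction n with
    | zero => simpa using ih
    | succ n ihn =>
      rw [Function.iterate_succ_apply']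
      exact partialD_smooth i ihn

/-- `w` is the weak derivative `D^β v` in `Ω`. -/
def IsWeakDeriv {d : ℕ} (Ω : Set (EuclideanSpace ℝ (Fin d))) (β : Fin d → ℕ)
    (v w : EuclideanSpace ℝ (Fin d) → ℝ) : Prop :=
  ∀ φ : EuclideanSpace ℝ (Fin d) → ℝ, ContDiff ℝ ∞ φ → HasCompactSupport φ → tsupport φ ⊆ Ω →
    ∫ x in Ω, multiD β φ x * v x = (-1) ^ (∑ i, β i) * ∫ x in Ω, φ x * w x

theorem integrable_smul_Lp {X E : Type*} [TopologicalSpace X] [MeasurableSpace X]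
    [OpensMeasurableSpace X] [T2Space X] [LocallyCompactSpace X]
    [NormedAddCommGroup E] [NormedSpace ℝ E] {μ : Measure X} [IsLocallyFiniteMeasure μ]
    {p : ℝ≥0∞} [hp : Fact (1 ≤ p)] {φ : X → ℝ} (hφ : Continuous φ) (hc : HasCompactSupport φ)
    (v : Lp E p μ) : Integrable (fun x => φ x • v x) μ :=
  ((Lp.memLp v).locallyIntegrable hp.out).integrable_smul_left_of_hasCompactSupport hφ hc

/-- The Sobolev space `W^{κ,s}(Ω)`. A function `v` is represented by the family
`(D^β v)_{|β| ≤ κ}` of its weak derivatives in `L^s(Ω)`, the function itself being the component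
with `β = 0`; the norm is `(∑ ‖D^β v‖^s)^{1/s}` (for `s < ∞`). -/
def SobolevSpace {d : ℕ} (Ω : Set (EuclideanSpace ℝ (Fin d))) (κ : ℕ) (s : ℝ≥0∞)
    [Fact (1 ≤ s)] :
    Submodule ℝ (PiLp s fun _ : MultiIdx d κ => Lp ℝ s (volume.restrict Ω)) where
  carrier := {v | ∀ β, IsWeakDeriv Ω (fun i => (β.1 i : ℕ)) (v (MultiIdx.zero d κ)) (v β)}
  zero_mem' := by
    intro β φ _ _ _
    have h : ∀ γ : MultiIdx d κ,
        (0 : PiLp s fun _ : MultiIdx d κ => Lp ℝ s (volume.restrict Ω)) γ =ᵐ[volume.restrict Ω]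
          fun _ => (0 : ℝ) := fun γ => Lp.coeFn_zero _ _ _
    rw [integral_congr_ae (g := fun _ => 0)
        ((h (MultiIdx.zero d κ)).mono fun x hx => (congrArg _ hx).trans (mul_zero _)),
      integral_congr_ae (g := fun _ => 0)
        ((h β).mono fun x hx => (congrArg _ hx).trans (mul_zero _))]
    simp only [integral_zero, mul_zero]
  add_mem' := by
    intro a b ha hb β φ h1 h2 h3
    have key : ∀ (γ : MultiIdx d κ) (ψ : EuclideanSpace ℝ (Fin d) → ℝ),
        ContDiff ℝ ∞ ψ ∧ HasCompactSupport ψ →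
        ∫ x in Ω, ψ x * (a + b) γ x = (∫ x in Ω, ψ x * a γ x) + ∫ x in Ω, ψ x * b γ x := by
      intro γ ψ hψ
      have h := integral_add (integrable_smul_Lp hψ.1.continuous hψ.2 (a γ))
        (integrable_smul_Lp hψ.1.continuous hψ.2 (b γ))
      simp only [smul_eq_mul] at h
      rw [← h]
      refine integral_congr_ae ((Lp.coeFn_add (a γ) (b γ)).mono fun x hx => ?_)
      have : (a + b) γ x = a γ x + b γ x := hx
      simp only [this, mul_add]
    rw [key _ _ (multiD_smooth _ ⟨h1, h2⟩), key _ _ ⟨h1, h2⟩, ha β φ h1 h2 h3, hb β φ h1 h2 h3,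
      mul_add]
  smul_mem' := by
    intro c a ha β φ h1 h2 h3
    have key : ∀ (γ : MultiIdx d κ) (ψ : EuclideanSpace ℝ (Fin d) → ℝ),
        ∫ x in Ω, ψ x * (c • a) γ x = c * ∫ x in Ω, ψ x * a γ x := by
      intro γ ψ
      rw [← integral_const_mul]
      refine integral_congr_ae ((Lp.coeFn_smul c (a γ)).mono fun x hx => ?_)
      have : (c • a) γ x = c * a γ x := hx
      simp only [this]
      ring
    rw [key, key, ha β φ h1 h2 h3]
    ring

/-! ### Sobolev–Bochner spaces in time -/

/-- The first Sobolev–Bochner space `W^{1,p,p}(0,T;E)`. A function `u` is represented by the pair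
`(u, ∂ₜu)` of elements of `L^p(0,T;E)`; the norm is `‖u‖ + ‖∂ₜu‖`. -/
def SobolevBochner (E : Type*) [NormedAddCommGroup E] [NormedSpace ℝ E] (p : ℝ≥0∞)
    [Fact (1 ≤ p)] (T : ℝ) :
    Submodule ℝ (WithLp 1 (Lp E p (volume.restrict (Ioo 0 T)) ×
      Lp E p (volume.restrict (Ioo 0 T)))) where
  carrier := {u | ∀ φ : ℝ → ℝ, ContDiff ℝ ∞ φ → HasCompactSupport φ → tsupport φ ⊆ Ioo 0 T →
    ∫ t in Ioo 0 T, deriv φ t • u.fst t = -∫ t in Ioo 0 T, φ t • u.snd t}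
  zero_mem' := by
    intro φ _ _ _
    have h : ((0 : Lp E p (volume.restrict (Ioo 0 T))) : ℝ → E) =ᵐ[volume.restrict (Ioo 0 T)]
        fun _ => (0 : E) := Lp.coeFn_zero _ _ _
    rw [WithLp.zero_fst, WithLp.zero_snd,
      integral_congr_ae (g := fun _ => 0)
        (h.mono fun x hx => (congrArg _ hx).trans (smul_zero _)),
      integral_congr_ae (g := fun _ => 0)
        (h.mono fun x hx => (congrArg _ hx).trans (smul_zero _))]
    simp only [integral_zero, neg_zero]
  add_mem' := by
    intro a b ha hb φ h1 h2 h3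
    have key : ∀ (v w : Lp E p (volume.restrict (Ioo 0 T))) (ψ : ℝ → ℝ),
        Continuous ψ → HasCompactSupport ψ →
        ∫ t in Ioo 0 T, ψ t • (v + w) t =
          (∫ t in Ioo 0 T, ψ t • v t) + ∫ t in Ioo 0 T, ψ t • w t := by
      intro v w ψ hψ hc
      rw [← integral_add (integrable_smul_Lp hψ hc v) (integrable_smul_Lp hψ hc w)]
      refine integral_congr_ae ((Lp.coeFn_add v w).mono fun x hx => ?_)
      simp only [hx, Pi.add_apply, smul_add]
    rw [WithLp.add_fst, WithLp.add_snd, key _ _ _ (h1.continuous_deriv (by simp)) h2.deriv,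
      key _ _ _ h1.continuous h2, ha φ h1 h2 h3, hb φ h1 h2 h3]
    abel
  smul_mem' := by
    intro c a ha φ h1 h2 h3
    have key : ∀ (v : Lp E p (volume.restrict (Ioo 0 T))) (ψ : ℝ → ℝ),
        ∫ t in Ioo 0 T, ψ t • (c • v) t = c • ∫ t in Ioo 0 T, ψ t • v t := by
      intro v ψ
      rw [← integral_smul]
      refine integral_congr_ae ((Lp.coeFn_smul c v).mono fun x hx => ?_)
      simp only [hx, Pi.smul_apply]
      rw [smul_comm]
    rw [WithLp.smul_fst, WithLp.smul_snd, key, key, ha φ h1 h2 h3, smul_neg]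

/-- The dynamic state space `L^p(0,T;V) ∩ W^{1,p,p}(0,T;V')`, for an embedding `ι` of `V` into
`V'`, with the sum of the two norms. -/
def StateSpace {V V' : Type*} [NormedAddCommGroup V] [NormedSpace ℝ V]
    [NormedAddCommGroup V'] [NormedSpace ℝ V'] (ι : V →L[ℝ] V') (p : ℝ≥0∞) [Fact (1 ≤ p)]
    (T : ℝ) :
    Submodule ℝ (WithLp 1 (Lp V p (volume.restrict (Ioo 0 T)) × SobolevBochner V' p T)) where
  carrier := {u | (u.snd : WithLp 1 (Lp V' p (volume.restrict (Ioo 0 T)) ×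
    Lp V' p (volume.restrict (Ioo 0 T)))).fst = ι.compLpL p (volume.restrict (Ioo 0 T)) u.fst}
  zero_mem' := by
    simp
  add_mem' := by
    intro a b ha hb
    simp only [mem_ofPred_eq] at *
    simp [ha, hb]
  smul_mem' := by
    intro c a ha
    simp only [mem_ofPred_eq] at *
    simp [ha]

namespace StateSpace

variable {V V' : Type*} [NormedAddCommGroup V] [NormedSpace ℝ V]
  [NormedAddCommGroup V'] [NormedSpace ℝ V'] {ι : V →L[ℝ] V'} {p : ℝ≥0∞} [Fact (1 ≤ p)] {T : ℝ}

/-- The state as an element of `L^p(0,T;V)`. -/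
def state (u : StateSpace ι p T) : Lp V p (volume.restrict (Ioo 0 T)) := u.1.fst

/-- The time derivative of the state, as an element of `L^p(0,T;V')`. -/
def timeDeriv (u : StateSpace ι p T) : Lp V' p (volume.restrict (Ioo 0 T)) := u.1.snd.1.snd

/-- The time derivative of the state, as an element of `L^q(0,T;W)`, where `q ≤ p` and `j` embeds
`V'` into `W`. -/
def timeDerivIn {W : Type*} [NormedAddCommGroup W] [NormedSpace ℝ W] (j : V' →L[ℝ] W)
    {q : ℝ≥0∞} (hqp : q ≤ p) (u : StateSpace ι p T) : Lp W q (volume.restrict (Ioo 0 T)) :=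
  AddSubgroup.inclusion (Lp.antitone hqp) (j.compLp (timeDeriv u))

end StateSpace

/-! ### Embeddings, weak convergence, the minimization problem -/

/-- Reflexivity of a normed space: the canonical map into the bidual is onto. -/
def IsReflexiveSpace (E : Type*) [NormedAddCommGroup E] [NormedSpace ℝ E] : Prop :=
  Function.Surjective (NormedSpace.inclusionInDoubleDual ℝ E)

/-- Weak convergence of a sequence in a normed space. -/
def WeaklyTendsto {E : Type*} [NormedAddCommGroup E] [NormedSpace ℝ E] (x : ℕ → E) (a : E) :
    Prop :=
  ∀ ℓ : E →L[ℝ] ℝ, Tendsto (fun n => ℓ (x n)) atTop (𝓝 (ℓ a))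

/-- Weak-weak (sequential) continuity of a possibly nonlinear map. -/
def WeakWeakContinuous {E F : Type*} [NormedAddCommGroup E] [NormedSpace ℝ E]
    [NormedAddCommGroup F] [NormedSpace ℝ F] (K : E → F) : Prop :=
  ∀ (x : ℕ → E) (a : E), WeaklyTendsto x a → WeaklyTendsto (fun n => K (x n)) (K a)

section Problem

variable {d κ : ℕ} {Ω : Set (EuclideanSpace ℝ (Fin d))} {T : ℝ}
  {s s' p q r : ℝ≥0∞} [Fact (1 ≤ s)] [Fact (1 ≤ s')] [Fact (1 ≤ p)] [Fact (1 ≤ q)] [Fact (1 ≤ r)]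
  {V V' W Y : Type*} [NormedAddCommGroup V] [NormedSpace ℝ V]
  [NormedAddCommGroup V'] [NormedSpace ℝ V'] [NormedAddCommGroup W] [NormedSpace ℝ W]
  [NormedAddCommGroup Y] [NormedSpace ℝ Y]

/-- The element `v` of `W^{κ,s}(Ω)` and the element `w` of `V'` are the same element of the space
`W`, into which `L^{s'}(Ω)` and `V'` are embedded by `i` and `j`. -/
def SameIn (i : Lp ℝ s' (volume.restrict Ω) →L[ℝ] W) (j : V' →L[ℝ] W)
    (v : SobolevSpace Ω κ s) (w : V') : Prop :=
  ∃ g : Lp ℝ s' (volume.restrict Ω),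
    g =ᵐ[volume.restrict Ω] v.1 (MultiIdx.zero d κ) ∧ i g = j w

/-- The jet `𝒥_κ u(t, x) = (D^β u(t, x))_{|β| ≤ κ}` of a state, where `e` embeds `V` into
`W^{κ,s}(Ω)`. -/
def jet (e : V →L[ℝ] SobolevSpace Ω κ s) {ι : V →L[ℝ] V'} (u : StateSpace ι p T)
    (t : ℝ) (x : EuclideanSpace ℝ (Fin d)) : MultiIdx d κ → ℝ :=
  fun β => (e (StateSpace.state u t)).1 β x

/-- `w ∈ L^q(0,T;W)` is the image of the jet of `u` under the Nemytskii operator of `f`: for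
almost every `t`, the function `f(t, 𝒥_κ u(t, ·))` belongs to `L^{s'}(Ω)`, and `w(t)` is this
function, regarded as an element of `W` through the embedding `i`. -/
def IsNemytskii (e : V →L[ℝ] SobolevSpace Ω κ s) (i : Lp ℝ s' (volume.restrict Ω) →L[ℝ] W)
    {ι : V →L[ℝ] V'} (f : ℝ → (MultiIdx d κ → ℝ) → ℝ) (u : StateSpace ι p T)
    (w : Lp W q (volume.restrict (Ioo 0 T))) : Prop :=
  ∀ᵐ t ∂(volume.restrict (Ioo 0 T)), ∃ g : Lp ℝ s' (volume.restrict Ω),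
    (∀ᵐ x ∂(volume.restrict Ω), g x = f t (jet e u t x)) ∧ w t = i g

open Classical in
/-- The Nemytskii operator of `f`, applied to the jet of `u`, with values in `L^q(0,T;W)`
(and the value `0` in case it is not well defined). -/
def nemytskii (e : V →L[ℝ] SobolevSpace Ω κ s) (i : Lp ℝ s' (volume.restrict Ω) →L[ℝ] W)
    {ι : V →L[ℝ] V'} (f : ℝ → (MultiIdx d κ → ℝ) → ℝ) (u : StateSpace ι p T) :
    Lp W q (volume.restrict (Ioo 0 T)) :=
  if h : ∃ w : Lp W q (volume.restrict (Ioo 0 T)), IsNemytskii e i f u w then h.choose else 0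

/-- The objective functional
`lam ‖∂ₜu - f(𝒥_κ u)‖^q + mu ‖K u - y‖^r + ‖u‖^p + R₀`. -/
def objective (e : V →L[ℝ] SobolevSpace Ω κ s) (i : Lp ℝ s' (volume.restrict Ω) →L[ℝ] W)
    {ι : V →L[ℝ] V'} (j : V' →L[ℝ] W) (hqp : q ≤ p) (lam mu : ℝ)
    (K : StateSpace ι p T → Lp Y r (volume.restrict (Ioo 0 T)))
    (y : Lp Y r (volume.restrict (Ioo 0 T)))
    (f : ℝ → (MultiIdx d κ → ℝ) → ℝ) (R₀ : ℝ≥0∞) (u : StateSpace ι p T) : ℝ≥0∞ :=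
  ENNReal.ofReal
    (lam * ‖StateSpace.timeDerivIn j hqp u - nemytskii e i f u‖ ^ q.toReal
      + mu * ‖K u - y‖ ^ r.toReal + ‖u‖ ^ p.toReal) + R₀

end Problem

end

/-! The proof is the direct method. Along a minimizing sequence the term `‖u‖^p` bounds the states
and the coercive `R₀` bounds the parameters. Parameters live in a closed subset of a
finite-dimensional space, so a subsequence converges. States converge weakly along a further
subsequence, and the norms are weakly lower semicontinuous. What remains is to pass to the limit in
the residual: its derivative part is linear and bounded, hence weakly continuous, while the network
part is nonlinear and needs strong convergence.

Weak compactness of the state space comes from reflexivity. If `E` is reflexive and separable and `1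
< p < ∞`, every functional on `L^p(E)` is represented by an element of `L^q(E*)` with `q` conjugate
to `p` (`exists_dual_representation`). Two applications make `L^p(E)` reflexive, and its dual is
separable, so sequential Banach–Alaoglu applies. The state space is a closed subspace of a product
of such spaces (`weaklySeqCompact_stateSpace`).

Strong convergence comes from an Aubin–Lions argument (`tendsto_integral_norm_of_weaklyTendsto`).
Ehrling's inequality bounds the Sobolev norm by a small multiple of the `V` norm plus a multiple of
the `W` norm. In `W` a function with integrable weak derivative is, on a fine partition, close to
its averages, and averages of a weakly null sequence tend to zero through the compact embedding. A
subsequence then converges in the Sobolev space at almost every time.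

The uniform bound on jets removes any need for growth conditions on the network: along a bounded
sequence of states its arguments may be truncated to a fixed cube without changing anything. The
truncated network is bounded and jointly continuous in parameter, time and jet, so bounded
convergence, once in space and once in time, gives norm convergence in `L^q(0,T;W)`
(`continuous_superposition`, `tendsto_path`). The same truncation shows that the network operator is
well defined. -/

noncomputable section

/-! ### Weak sequential compactness -/

section Weak

variable {E F : Type*} [NormedAddCommGroup E] [NormedSpace ℝ E] [NormedAddCommGroup F]
  [NormedSpace ℝ F]

/-- Almost norming vectors for a dense sequence of functionals span a dense subspace: a nonzero
functional vanishing on the span would be close to some member of the sequence, which is large on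
its own vector. -/
theorem separableSpace_of_strongDual [TopologicalSpace.SeparableSpace (StrongDual ℝ E)] :
    TopologicalSpace.SeparableSpace E := by
  have hx : ∀ f : StrongDual ℝ E, ∃ x : E, ‖x‖ ≤ 1 ∧ ‖f‖ / 2 ≤ f x := by
    intro f
    rcases eq_or_ne f 0 with rfl | hf
    · exact ⟨0, by simp, by simp⟩
    obtain ⟨x, hx1, hx2⟩ := f.exists_lt_apply_of_lt_opNorm (half_lt_self (norm_pos_iff.2 hf))
    rcases le_total 0 (f x) with h | h
    · exact ⟨x, hx1.le, by rw [Real.norm_of_nonneg h] at hx2; exact hx2.le⟩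
    · refine ⟨-x, by simpa using hx1.le, ?_⟩
      rw [Real.norm_of_nonpos h] at hx2
      simpa using hx2.le
  choose x hx1 hx2 using hx
  let f := TopologicalSpace.denseSeq (StrongDual ℝ E)
  let S : Submodule ℝ E := Submodule.span ℝ (range fun n => x (f n))
  have hS : TopologicalSpace.IsSeparable (S : Set E) :=
    (countable_range _).isSeparable.span
  have htop : S.topologicalClosure = ⊤ := by
    by_contra hne
    obtain ⟨a, ha⟩ : ∃ a, a ∉ S.topologicalClosure := by
      by_contra! h
      exact hne (eq_top_iff.2 fun a _ => h a)
    obtain ⟨g, u, hg1, hg2⟩ := geometric_hahn_banach_closed_point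
      S.topologicalClosure.convex S.isClosed_topologicalClosure ha
    -- A functional bounded above by `u` on a subspace vanishes there; otherwise some multiple of
    -- `b` has the value `u + 1`.
    have hker : ∀ b ∈ S.topologicalClosure, g b = 0 := by
      intro b hb
      by_contra hgb
      have := hg1 (((u + 1) / g b) • b) (S.topologicalClosure.smul_mem _ hb)
      rw [map_smul, smul_eq_mul, div_mul_cancel₀ _ hgb] at this
      linarith
    have hg0 : g ≠ 0 := by
      rintro rfl
      have := hg1 0 (zero_mem _)
      simp at this hg2
      linarith
    have hpos := norm_pos_iff.2 hg0
    -- The constant 1/4 suffices: `‖f n‖ / 2` exceeds `3‖g‖/8`, yet it is at most `(f n - g) (x (f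
    -- n))`, which is below `‖g‖/4`.
    obtain ⟨n, hn⟩ := (TopologicalSpace.denseRange_denseSeq (StrongDual ℝ E)).exists_dist_lt g
      (show (0 : ℝ) < ‖g‖ / 4 by positivity)
    have h1 : g (x (f n)) = 0 :=
      hker _ (S.le_topologicalClosure (Submodule.subset_span ⟨n, rfl⟩))
    have h2 : |(f n - g) (x (f n))| ≤ ‖f n - g‖ :=
      ((f n - g).le_opNorm _).trans (mul_le_of_le_one_right (norm_nonneg _) (hx1 _))
    rw [dist_eq_norm, norm_sub_rev] at hn
    have h3 := hx2 (f n)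
    have h4 : ‖g‖ ≤ ‖f n‖ + ‖f n - g‖ := by
      have := norm_sub_le (f n) (f n - g)
      rwa [sub_sub_cancel] at this
    have h5 := le_abs_self ((f n - g) (x (f n)))
    rw [sub_apply, h1, sub_zero] at h5 h2
    have hn' : ‖f n - g‖ < ‖g‖ / 4 := hn
    linarith
  have h : TopologicalSpace.IsSeparable (univ : Set E) := by
    have := hS.closure
    rwa [← Submodule.topologicalClosure_coe, htop, Submodule.top_coe] at this
  exact TopologicalSpace.isSeparable_univ_iff.1 h

/-- The canonical isometry onto the bidual of a reflexive space. -/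
def IsReflexiveSpace.equiv (h : IsReflexiveSpace E) : E ≃ₗᵢ[ℝ] StrongDual ℝ (StrongDual ℝ E) :=
  LinearIsometryEquiv.ofSurjective (NormedSpace.inclusionInDoubleDualLi ℝ) h

theorem IsReflexiveSpace.equiv_apply (h : IsReflexiveSpace E) (x : E) (ℓ : StrongDual ℝ E) :
    h.equiv x ℓ = ℓ x := rfl

theorem IsReflexiveSpace.separableSpace_bidual (h : IsReflexiveSpace E)
    [TopologicalSpace.SeparableSpace E] :
    TopologicalSpace.SeparableSpace (StrongDual ℝ (StrongDual ℝ E)) :=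
  h.equiv.surjective.denseRange.separableSpace h.equiv.continuous

theorem IsReflexiveSpace.separableSpace_dual (h : IsReflexiveSpace E)
    [TopologicalSpace.SeparableSpace E] :
    TopologicalSpace.SeparableSpace (StrongDual ℝ E) :=
  have := h.separableSpace_bidual
  separableSpace_of_strongDual

variable (E) in
/-- Every bounded sequence has a weakly convergent subsequence. -/
def WeaklySeqCompact : Prop :=
  ∀ x : ℕ → E, (∃ C : ℝ, ∀ n, ‖x n‖ ≤ C) →
    ∃ (a : E) (φ : ℕ → ℕ), StrictMono φ ∧ WeaklyTendsto (fun n => x (φ n)) a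

/-- Seen in the bidual, the sequence is bounded in the dual of a separable space. Sequential
Banach–Alaoglu gives a weak-* limit, and reflexivity returns it to `E`. -/
theorem IsReflexiveSpace.weaklySeqCompact (h : IsReflexiveSpace E)
    [TopologicalSpace.SeparableSpace (StrongDual ℝ E)] : WeaklySeqCompact E := by
  rintro x ⟨C, hC⟩
  obtain ⟨a, -, φ, hφ, ha⟩ := WeakDual.isSeqCompact_closedBall ℝ (StrongDual ℝ E) 0 C
    (x := fun n => StrongDual.toWeakDual (h.equiv (x n))) (fun n => by
      have : ‖h.equiv (x n)‖ ≤ C := (h.equiv.norm_map _).trans_le (hC n)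
      simpa using this)
  obtain ⟨b, hb⟩ := h.equiv.surjective (WeakDual.toStrongDual a)
  refine ⟨b, φ, hφ, fun ℓ => ?_⟩
  have h1 := (WeakDual.eval_continuous ℓ).continuousAt.tendsto.comp ha
  have h2 : ℓ b = a ℓ := by
    rw [← h.equiv_apply, hb]
    rfl
  rw [h2]
  exact h1

theorem WeaklyTendsto.map {x : ℕ → E} {a : E} (h : WeaklyTendsto x a) (T : E →L[ℝ] F) :
    WeaklyTendsto (fun n => T (x n)) (T a) := fun ℓ => h (ℓ.comp T)

theorem WeaklyTendsto.comp {x : ℕ → E} {a : E} (h : WeaklyTendsto x a) {φ : ℕ → ℕ}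
    (hφ : StrictMono φ) : WeaklyTendsto (fun n => x (φ n)) a :=
  fun ℓ => (h ℓ).comp hφ.tendsto_atTop

theorem WeaklyTendsto.sub {x y : ℕ → E} {a b : E} (h : WeaklyTendsto x a)
    (h' : WeaklyTendsto y b) : WeaklyTendsto (fun n => x n - y n) (a - b) := fun ℓ => by
  simpa using (h ℓ).sub (h' ℓ)

theorem weaklyTendsto_of_tendsto {x : ℕ → E} {a : E} (h : Tendsto x atTop (𝓝 a)) :
    WeaklyTendsto x a := fun ℓ => (ℓ.continuous.tendsto a).comp h

theorem WeaklyTendsto.norm_le {x : ℕ → E} {a : E} (h : WeaklyTendsto x a) {c : ℝ}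
    (hc : Tendsto (fun n => ‖x n‖) atTop (𝓝 c)) : ‖a‖ ≤ c := by
  obtain ⟨ℓ, hℓ1, hℓ2⟩ := exists_dual_vector'' ℝ a
  have h2 : ℓ a = ‖a‖ := hℓ2
  rw [← h2]
  refine le_of_tendsto_of_tendsto' (h ℓ) hc fun n => ?_
  calc ℓ (x n) ≤ ‖ℓ (x n)‖ := le_abs_self _
    _ ≤ ‖ℓ‖ * ‖x n‖ := ℓ.le_opNorm _
    _ ≤ ‖x n‖ := mul_le_of_le_one_left (norm_nonneg _) hℓ1

/-- Uniform boundedness for the evaluations on the dual; the dual is complete, so `E` need not be.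
-/
theorem WeaklyTendsto.bounded {x : ℕ → E} {a : E} (h : WeaklyTendsto x a) :
    ∃ C : ℝ, ∀ n, ‖x n‖ ≤ C := by
  obtain ⟨C, hC⟩ := banach_steinhaus (g := fun n => NormedSpace.inclusionInDoubleDual ℝ E (x n))
    (fun ℓ => by
      obtain ⟨C, hC⟩ := (h ℓ).norm.bddAbove_range
      exact ⟨C, fun n => hC ⟨n, rfl⟩⟩)
  exact ⟨C, fun n =>
    ((NormedSpace.inclusionInDoubleDualLi (E := E) ℝ).norm_map (x n)).symm.trans_le (hC n)⟩

theorem WeaklySeqCompact.of_equiv (h : WeaklySeqCompact E) (T : E ≃L[ℝ] F) :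
    WeaklySeqCompact F := by
  rintro x ⟨C, hC⟩
  obtain ⟨a, φ, hφ, ha⟩ := h (fun n => T.symm (x n))
    ⟨‖(T.symm : F →L[ℝ] E)‖ * C, fun n => ((T.symm : F →L[ℝ] E).le_opNorm _).trans
      (mul_le_mul_of_nonneg_left (hC n) (norm_nonneg _))⟩
  refine ⟨T a, φ, hφ, ?_⟩
  simpa using ha.map (T : E →L[ℝ] F)

theorem WeaklySeqCompact.prod (h : WeaklySeqCompact E) (h' : WeaklySeqCompact F) :
    WeaklySeqCompact (E × F) := by
  rintro x ⟨C, hC⟩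
  obtain ⟨a, φ, hφ, ha⟩ := h (fun n => (x n).1) ⟨C, fun n => (norm_fst_le _).trans (hC n)⟩
  obtain ⟨b, ψ, hψ, hb⟩ := h' (fun n => (x (φ n)).2)
    ⟨C, fun n => (norm_snd_le _).trans (hC _)⟩
  refine ⟨(a, b), φ ∘ ψ, hφ.comp hψ, fun ℓ => ?_⟩
  have key : ∀ z : E × F, ℓ z = (ℓ.comp (ContinuousLinearMap.inl ℝ E F)) z.1 +
      (ℓ.comp (ContinuousLinearMap.inr ℝ E F)) z.2 := fun z => by
    simp [← map_add]
  rw [key]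
  simp_rw [key]
  exact ((ha.comp hψ) _).add (hb _)

/-- A closed convex set is weakly closed by separation, and functionals on the subspace extend by
Hahn–Banach, so both notions of weak convergence agree. -/
theorem WeaklySeqCompact.submodule (h : WeaklySeqCompact E) {S : Submodule ℝ E}
    (hS : IsClosed (S : Set E)) : WeaklySeqCompact S := by
  rintro x ⟨C, hC⟩
  obtain ⟨a, φ, hφ, ha⟩ := h (fun n => (x n : E)) ⟨C, hC⟩
  have haS : a ∈ S := by
    by_contra haS
    obtain ⟨g, u, hg1, hg2⟩ := geometric_hahn_banach_closed_point S.convex hS haS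
    exact hg2.not_ge (le_of_tendsto' (ha g) fun n => (hg1 _ (x (φ n)).2).le)
  refine ⟨⟨a, haS⟩, φ, hφ, fun ℓ => ?_⟩
  obtain ⟨g, hg, -⟩ := exists_extension_norm_eq S ℓ
  rw [← hg]
  simpa only [← hg] using ha g

/-- A compact operator maps weakly null sequences to null sequences. -/
theorem IsCompactOperator.tendsto_of_weaklyTendsto {T : E →L[ℝ] F} (hT : IsCompactOperator T)
    {x : ℕ → E} (h : WeaklyTendsto x 0) : Tendsto (fun n => T (x n)) atTop (𝓝 0) := by
  obtain ⟨C, hC⟩ := h.bounded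
  refine tendsto_of_subseq_tendsto fun ns hns => ?_
  have hcomp := IsCompactOperator.isCompact_closure_image_closedBall
    (f := (T : E →ₗ[ℝ] F)) hT C
  obtain ⟨s, -, ψ, hψ, hs⟩ := hcomp.tendsto_subseq (x := fun n => T (x (ns n)))
    fun n => subset_closure ⟨x (ns n), by simpa using hC _, rfl⟩
  -- Any cluster point of the images is also their weak limit, and that limit is zero.
  have hs0 : s = 0 := by
    refine SeparatingDual.eq_zero_of_forall_dual_eq_zero (R := ℝ) fun ℓ => ?_
    refine tendsto_nhds_unique ((ℓ.continuous.tendsto s).comp hs) ?_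
    have := ((h.map T) ℓ).comp (hns.comp hψ.tendsto_atTop)
    simpa [Function.comp_def] using this
  exact ⟨ψ, hs0 ▸ hs⟩

/-- Ehrling's inequality. -/
theorem ehrling {G : Type*} [NormedAddCommGroup G] [NormedSpace ℝ G] (hE : WeaklySeqCompact E)
    {T : E →L[ℝ] F} (hT : IsCompactOperator T) {S : E →L[ℝ] G} (hS : Function.Injective S)
    {η : ℝ} (hη : 0 < η) : ∃ C : ℝ, 0 ≤ C ∧ ∀ v, ‖T v‖ ≤ η * ‖v‖ + C * ‖S v‖ := by
  by_contra! hcon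
  -- Normalized counterexamples satisfy `n ‖S v‖ ≤ ‖T‖`, so `S v → 0`. Injectivity of `S` forces the
  -- weak limit to be zero, compactness then gives `T v → 0`, contradicting `η < ‖T v‖`.
  have h1 : ∀ n : ℕ, ∃ v : E, ‖v‖ = 1 ∧ η + n * ‖S v‖ < ‖T v‖ := by
    intro n
    obtain ⟨v, hv⟩ := hcon n n.cast_nonneg
    have hv0 : v ≠ 0 := by
      rintro rfl
      simp at hv
    have hpos : 0 < ‖v‖ := norm_pos_iff.2 hv0
    refine ⟨‖v‖⁻¹ • v, by simp [norm_smul, hpos.ne'], ?_⟩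
    rw [map_smul, map_smul, norm_smul, norm_smul, norm_inv, norm_norm]
    rw [← mul_lt_mul_iff_right₀ hpos]
    field_simp
    linarith
  choose v hv1 hv2 using h1
  obtain ⟨a, φ, hφ, ha⟩ := hE v ⟨1, fun n => (hv1 n).le⟩
  have hbd : ∀ n, ‖T (v n)‖ ≤ ‖T‖ := fun n => by
    simpa [hv1 n] using T.le_opNorm (v n)
  have hS0 : Tendsto (fun n => S (v (φ n))) atTop (𝓝 0) := by
    rw [tendsto_zero_iff_norm_tendsto_zero]
    have h2 : Tendsto (fun n : ℕ => ‖T‖ / n) atTop (𝓝 0) :=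
      tendsto_const_div_atTop_nhds_zero_nat _
    refine squeeze_zero' (Eventually.of_forall fun n => norm_nonneg _) ?_
      (h2.comp hφ.tendsto_atTop)
    filter_upwards [eventually_gt_atTop 0] with n hn
    have hpos : (0 : ℝ) < φ n := by
      exact_mod_cast hn.trans_le (hφ.id_le n)
    have := hv2 (φ n)
    have := hbd (φ n)
    simp only [Function.comp]
    rw [le_div_iff₀ hpos]
    linarith
  have ha0 : a = 0 := by
    apply hS
    rw [map_zero]
    refine SeparatingDual.eq_zero_of_forall_dual_eq_zero (R := ℝ) fun ℓ => ?_
    refine tendsto_nhds_unique ((ha.map S) ℓ) ?_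
    simpa [Function.comp_def] using (ℓ.continuous.tendsto 0).comp hS0
  subst ha0
  have h3 := (hT.tendsto_of_weaklyTendsto ha).norm
  rw [norm_zero] at h3
  refine hη.not_ge (ge_of_tendsto' h3 fun n => ?_)
  have := hv2 (φ n)
  have : 0 ≤ (φ n : ℝ) * ‖S (v (φ n))‖ := by positivity
  linarith

end Weak

/-! ### Bounded convergence in `L^p` -/

section BoundedConvergence

variable {α F : Type*} [MeasurableSpace α] {μ : Measure α} [IsFiniteMeasure μ]
  [NormedAddCommGroup F] {p : ℝ≥0∞}

/-- On a finite measure space the constant `(2C)^p` is an integrable majorant. -/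
theorem tendsto_eLpNorm_sub_of_bounded (hp0 : p ≠ 0) (hp : p ≠ ⊤) {f : ℕ → α → F} {g : α → F}
    (hf : ∀ n, AEStronglyMeasurable (f n) μ) {C : ℝ} (hbd : ∀ n, ∀ᵐ x ∂μ, ‖f n x‖ ≤ C)
    (hlim : ∀ᵐ x ∂μ, Tendsto (fun n => f n x) atTop (𝓝 (g x))) :
    Tendsto (fun n => eLpNorm (f n - g) p μ) atTop (𝓝 0) := by
  have hP : 0 < p.toReal := ENNReal.toReal_pos hp0 hp
  have hg : AEStronglyMeasurable g μ := aestronglyMeasurable_of_tendsto_ae atTop hf hlim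
  have hgC : ∀ᵐ x ∂μ, ‖g x‖ ≤ C := by
    filter_upwards [hlim, ae_all_iff.2 hbd] with x hx hx'
    exact le_of_tendsto' hx.norm hx'
  have key : Tendsto (fun n => ∫⁻ x, ‖(f n - g) x‖ₑ ^ p.toReal ∂μ) atTop
      (𝓝 (∫⁻ _, 0 ∂μ)) := by
    refine tendsto_lintegral_of_dominated_convergence' (fun _ => ENNReal.ofReal (2 * C) ^ p.toReal)
      (fun n => ((hf n).sub hg).enorm.pow_const _) (fun n => ?_) ?_ ?_
    · filter_upwards [hbd n, hgC] with x hx hx'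
      refine ENNReal.rpow_le_rpow ?_ hP.le
      rw [← ofReal_norm]
      refine ENNReal.ofReal_le_ofReal ((norm_sub_le _ _).trans (by linarith))
    · rw [lintegral_const]
      exact ENNReal.mul_ne_top (ENNReal.rpow_ne_top_of_nonneg hP.le ENNReal.ofReal_ne_top)
        (measure_ne_top _ _)
    · filter_upwards [hlim] with x hx
      have h1 : Tendsto (fun n => ‖(f n - g) x‖ₑ) atTop (𝓝 0) := by
        have h2 := (hx.sub_const (g x)).enorm
        simpa using h2
      have h3 := (ENNReal.continuous_rpow_const (y := p.toReal)).tendsto 0 |>.comp h1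
      simpa [hP, Function.comp_def] using h3
  have h4 := (ENNReal.continuous_rpow_const (y := 1 / p.toReal)).tendsto _ |>.comp key
  simp only [lintegral_zero, one_div] at h4
  rw [ENNReal.zero_rpow_of_pos (inv_pos.2 hP)] at h4
  refine h4.congr fun n => ?_
  rw [eLpNorm_eq_lintegral_rpow_enorm_toReal hp0 hp, one_div]
  rfl

theorem tendsto_toLp_of_bounded [Fact (1 ≤ p)] (hp : p ≠ ⊤) {f : ℕ → α → F} {g : α → F}
    (hf : ∀ n, MemLp (f n) p μ) (hg : MemLp g p μ) {C : ℝ} (hbd : ∀ n, ∀ᵐ x ∂μ, ‖f n x‖ ≤ C)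
    (hlim : ∀ᵐ x ∂μ, Tendsto (fun n => f n x) atTop (𝓝 (g x))) :
    Tendsto (fun n => (hf n).toLp (f n)) atTop (𝓝 (hg.toLp g)) :=
  (Lp.tendsto_Lp_iff_tendsto_eLpNorm'' _ hf _ hg).2 <|
    tendsto_eLpNorm_sub_of_bounded (zero_lt_one.trans_le Fact.out).ne' hp (fun n => (hf n).1)
      hbd hlim

end BoundedConvergence

/-! ### The dual of a Bochner space -/

theorem memLp_smul_of_bounded {α E : Type*} [MeasurableSpace α] {μ : Measure α}
    [IsFiniteMeasure μ] [NormedAddCommGroup E] [NormedSpace ℝ E] {p : ℝ≥0∞} {φ : α → ℝ}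
      (hφ : Measurable φ) {C : ℝ} (hC : ∀ t, |φ t| ≤ C)
    {u : α → E} (hu : StronglyMeasurable u) {D : ℝ} (hD : ∀ t, ‖u t‖ ≤ D) :
    MemLp (fun t => φ t • u t) p μ := by
  refine MemLp.of_bound (hφ.stronglyMeasurable.smul hu).aestronglyMeasurable (C * D)
    (Eventually.of_forall fun t => ?_)
  rw [norm_smul]
  exact mul_le_mul (hC t) (hD t) (norm_nonneg _) ((abs_nonneg _).trans (hC t))

theorem integrable_bdd_mul {α : Type*} [MeasurableSpace α] {μ : Measure α} {φ g : α → ℝ}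
    (hφ : Measurable φ) {C : ℝ} (hC : ∀ t, |φ t| ≤ C)
    (hg : Integrable g μ) : Integrable (fun t => φ t * g t) μ :=
  hg.bdd_mul hφ.aestronglyMeasurable (Eventually.of_forall hC)

section BochnerDual

variable {α E : Type*} [MeasurableSpace α] {μ : Measure α} [IsFiniteMeasure μ]
  [NormedAddCommGroup E] [NormedSpace ℝ E] {p : ℝ≥0∞} [Fact (1 ≤ p)]

/-- This is the countable additivity behind the vector-valued Radon–Nikodym argument. It needs `p <
∞`, so that indicators of sets of small measure have small norm. -/
theorem hasSum_indicatorConstLp (hp : p ≠ ⊤) (v : E) {f : ℕ → Set α}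
    (hf : ∀ n, MeasurableSet (f n)) (hd : Pairwise (Function.onFun Disjoint f)) :
    HasSum (fun n => indicatorConstLp p (hf n) (measure_ne_top μ _) v)
      (indicatorConstLp p (MeasurableSet.iUnion hf) (measure_ne_top μ _) v) := by
  have hm : ∀ s : Finset ℕ, MeasurableSet (⋃ i ∈ s, f i) := fun s =>
    s.measurableSet_biUnion fun i _ => hf i
  have hfin : ∀ s : Finset ℕ, ∑ n ∈ s, indicatorConstLp p (hf n) (measure_ne_top μ _) v =
      indicatorConstLp p (hm s) (measure_ne_top μ _) v := by
    classical
    intro s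
    induction s using Finset.induction_on with
    | empty =>
      rw [Finset.sum_empty, ← indicatorConstLp_empty (c := v) (p := p) (μ := μ)]
      congr 1
      simp
    | insert a s ha ih =>
      rw [Finset.sum_insert ha, ih, ← indicatorConstLp_disjoint_union (hf a) (hm s)]
      · congr 1
        simp
      · refine disjoint_iUnion₂_right.2 fun i hi => hd ?_
        rintro rfl
        exact ha hi
  unfold HasSum
  simp_rw [hfin]
  refine tendsto_indicatorConstLp_set hp ?_
  have h1 : Tendsto (fun s : Finset ℕ => ∑' n : {n // n ∉ s}, μ (f n)) atTop (𝓝 0) := by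
    refine ENNReal.tendsto_tsum_compl_atTop_zero (f := fun n => μ (f n)) ?_
    rw [← measure_iUnion hd hf]
    exact measure_ne_top _ _
  -- The symmetric difference of a partial union and the full one is covered by the omitted sets,
  -- whose total measure is a tail of a convergent series.
  refine tendsto_of_tendsto_of_tendsto_of_le_of_le tendsto_const_nhds h1 (fun _ => zero_le)
    fun s => ?_
  refine (measure_mono ?_).trans (measure_iUnion_le (fun n : {n // n ∉ s} => f n))
  rintro x (⟨hx, hx'⟩ | ⟨hx, hx'⟩)
  · simp only [mem_iUnion] at hx hx'
    obtain ⟨i, -, hi⟩ := hx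
    exact (hx' ⟨i, hi⟩).elim
  · simp only [mem_iUnion, not_exists] at hx hx'
    obtain ⟨i, hi⟩ := hx
    exact mem_iUnion.2 ⟨⟨i, fun h => hx' i h hi⟩, hi⟩

/-- `g` is the density of the functional `φ ↦ Λ (φ v)`. -/
structure IsDensity (Λ : Lp E p μ →L[ℝ] ℝ) (v : E) (g : α → ℝ) : Prop where
  measurable : Measurable g
  integrable : Integrable g μ
  apply_eq : ∀ φ : α → ℝ, Measurable φ → (∃ C, ∀ t, |φ t| ≤ C) →
    ∀ h : MemLp (fun t => φ t • v) p μ, Λ (h.toLp _) = ∫ t, φ t * g t ∂μ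

/-- The set function `s ↦ Λ(1_s v)` is a signed measure, absolutely continuous with respect to `μ`;
its Radon–Nikodym derivative is the density. Linearity covers simple `φ`, bounded convergence covers
bounded measurable `φ`. -/
theorem exists_isDensity (hp : p ≠ ⊤) (Λ : Lp E p μ →L[ℝ] ℝ) (v : E) :
    ∃ g, IsDensity Λ v g := by
  classical
  let m : SignedMeasure α :=
    { measureOf' := fun s => if hs : MeasurableSet s then
        Λ (indicatorConstLp p hs (measure_ne_top μ s) v) else 0
      empty' := by
        rw [dif_pos MeasurableSet.empty, indicatorConstLp_empty, map_zero]
      not_measurable' := fun s hs => dif_neg hs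
      m_iUnion' := fun f hf hd => by
        simp only [hf, MeasurableSet.iUnion hf, dif_pos]
        exact Λ.hasSum (hasSum_indicatorConstLp hp v hf hd) }
  have hm : ∀ s (hs : MeasurableSet s),
      m s = Λ (indicatorConstLp p hs (measure_ne_top μ s) v) := fun s hs => dif_pos hs
  have hac : m ≪ᵥ μ.toENNRealVectorMeasure := by
    refine VectorMeasure.AbsolutelyContinuous.mk fun s hs h0 => ?_
    rw [Measure.toENNRealVectorMeasure_apply_measurable hs] at h0
    rw [hm s hs]
    have : indicatorConstLp p hs (measure_ne_top μ s) v = 0 := by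
      rw [← norm_eq_zero, norm_indicatorConstLp (zero_lt_one.trans_le Fact.out).ne' hp,
        measureReal_def, h0]
      have : 0 < p.toReal := ENNReal.toReal_pos (zero_lt_one.trans_le Fact.out).ne' hp
      simp [Real.zero_rpow, this.ne']
    rw [this, map_zero]
  have hg := m.integrable_rnDeriv μ
  have hgm : Measurable (m.rnDeriv μ) := SignedMeasure.measurable_rnDeriv _ _
  have hmg : ∀ s, MeasurableSet s → m s = ∫ t in s, m.rnDeriv μ t ∂μ := fun s hs => by
    rw [← withDensityᵥ_apply hg hs, SignedMeasure.withDensityᵥ_rnDeriv_eq _ _ hac]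
  generalize m.rnDeriv μ = g at hg hgm hmg
  have hbd : ∀ f : SimpleFunc α ℝ, ∃ C, ∀ t, |f t| ≤ C := fun f => f.exists_forall_norm_le
  have hsimple : ∀ f : SimpleFunc α ℝ, ∀ h : MemLp (fun t => f t • v) p μ,
      Λ (h.toLp _) = ∫ t, f t * g t ∂μ := by
    intro f
    induction f using SimpleFunc.induction with
    | const c hs =>
      rename_i s
      intro h
      have h1 : h.toLp _ = c • indicatorConstLp p hs (measure_ne_top μ s) v := by
        rw [indicatorConstLp, ← MemLp.toLp_const_smul]
        refine MemLp.toLp_congr _ _ (Eventually.of_forall fun t => ?_)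
        by_cases ht : t ∈ s <;> simp [ht]
      rw [h1, map_smul, ← hm, hmg s hs, smul_eq_mul, ← integral_const_mul,
        ← integral_indicator hs]
      refine integral_congr_ae (Eventually.of_forall fun t => ?_)
      by_cases ht : t ∈ s <;> simp [ht]
    | add hd h1 h2 =>
      rename_i f₁ f₂
      intro h
      obtain ⟨C₁, hC₁⟩ := hbd f₁
      obtain ⟨C₂, hC₂⟩ := hbd f₂
      have i₁ := integrable_bdd_mul f₁.measurable hC₁ hg
      have i₂ := integrable_bdd_mul f₂.measurable hC₂ hg
      have m₁ := memLp_smul_of_bounded (p := p) (μ := μ) f₁.measurable hC₁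
        (stronglyMeasurable_const (b := v)) (fun _ => le_rfl)
      have m₂ := memLp_smul_of_bounded (p := p) (μ := μ) f₂.measurable hC₂
        (stronglyMeasurable_const (b := v)) (fun _ => le_rfl)
      have h3 : h.toLp _ = m₁.toLp _ + m₂.toLp _ := by
        rw [← MemLp.toLp_add]
        exact MemLp.toLp_congr _ _ (Eventually.of_forall fun t => by simp [add_smul])
      rw [h3, map_add, h1 m₁, h2 m₂, ← integral_add i₁ i₂]
      simp [add_mul]
  refine ⟨g, hgm, hg, fun φ hφ ⟨C, hC⟩ h => ?_⟩
  let f := fun n => hφ.stronglyMeasurable.approxBounded C n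
  -- Bounded approximation requires `0 ≤ C`, which can fail only on an empty space.
  have hC0 : 0 ≤ C ∨ IsEmpty α := by
    by_cases hα : Nonempty α
    · exact Or.inl ((abs_nonneg _).trans (hC hα.some))
    · exact Or.inr (not_nonempty_iff.1 hα)
  have hfC : ∀ n t, |f n t| ≤ C := fun n t => by
    rcases hC0 with h0 | h0
    · exact hφ.stronglyMeasurable.norm_approxBounded_le h0 n t
    · exact (h0.false t).elim
  have hlim : ∀ t, Tendsto (fun n => f n t) atTop (𝓝 (φ t)) := fun t =>
    hφ.stronglyMeasurable.tendsto_approxBounded_of_norm_le (hC t)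
  have hmem : ∀ n, MemLp (fun t => f n t • v) p μ := fun n =>
    memLp_smul_of_bounded (f n).measurable (hfC n) stronglyMeasurable_const (fun _ => le_rfl)
  have t1 : Tendsto (fun n => Λ ((hmem n).toLp _)) atTop (𝓝 (Λ (h.toLp _))) := by
    refine (Λ.continuous.tendsto _).comp
      (tendsto_toLp_of_bounded hp hmem h (C := C * ‖v‖) (fun n => ?_) ?_)
    · refine Eventually.of_forall fun t => ?_
      rw [norm_smul]
      exact mul_le_mul_of_nonneg_right (hfC n t) (norm_nonneg _)
    · exact Eventually.of_forall fun t => (hlim t).smul_const v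
  have t2 : Tendsto (fun n => ∫ t, f n t * g t ∂μ) atTop (𝓝 (∫ t, φ t * g t ∂μ)) := by
    refine tendsto_integral_of_dominated_convergence (fun t => C * ‖g t‖)
      (fun n => (integrable_bdd_mul (f n).measurable (hfC n) hg).1) (hg.norm.const_mul C)
      (fun n => ?_) ?_
    · refine Eventually.of_forall fun t => ?_
      rw [norm_mul]
      exact mul_le_mul_of_nonneg_right (hfC n t) (norm_nonneg _)
    · exact Eventually.of_forall fun t => (hlim t).mul_const _
  refine tendsto_nhds_unique t1 (t2.congr fun n => ?_)
  exact (hsimple (f n) (hmem n)).symm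

theorem IsDensity.zero (Λ : Lp E p μ →L[ℝ] ℝ) : IsDensity Λ 0 (fun _ => 0) where
  measurable := measurable_const
  integrable := integrable_zero _ _ _
  apply_eq φ _ _ h := by
    have : h.toLp _ = 0 := by
      rw [← MemLp.toLp_zero (MemLp.zero' (p := p) (μ := μ) (ε := E))]
      exact MemLp.toLp_congr _ _ (Eventually.of_forall fun t => by simp)
    rw [this]
    simp

theorem IsDensity.add {Λ : Lp E p μ →L[ℝ] ℝ} {v w : E} {f g : α → ℝ} (hf : IsDensity Λ v f)
    (hg : IsDensity Λ w g) : IsDensity Λ (v + w) (fun t => f t + g t) where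
  measurable := hf.measurable.add hg.measurable
  integrable := hf.integrable.add hg.integrable
  apply_eq φ hφ hb h := by
    obtain ⟨C, hC⟩ := hb
    have m₁ := memLp_smul_of_bounded (p := p) (μ := μ) hφ hC
      (stronglyMeasurable_const (b := v)) (fun _ => le_rfl)
    have m₂ := memLp_smul_of_bounded (p := p) (μ := μ) hφ hC
      (stronglyMeasurable_const (b := w)) (fun _ => le_rfl)
    have h3 : h.toLp _ = m₁.toLp _ + m₂.toLp _ := by
      rw [← MemLp.toLp_add]
      exact MemLp.toLp_congr _ _ (Eventually.of_forall fun t => by simp)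
    rw [h3, map_add, hf.apply_eq φ hφ ⟨C, hC⟩ m₁, hg.apply_eq φ hφ ⟨C, hC⟩ m₂,
      ← integral_add (integrable_bdd_mul hφ hC hf.integrable)
        (integrable_bdd_mul hφ hC hg.integrable)]
    simp [mul_add]

theorem IsDensity.smul {Λ : Lp E p μ →L[ℝ] ℝ} {v : E} {g : α → ℝ} (hg : IsDensity Λ v g)
    (c : ℝ) : IsDensity Λ (c • v) (fun t => c * g t) where
  measurable := hg.measurable.const_mul c
  integrable := hg.integrable.const_mul c
  apply_eq φ hφ hb h := by
    obtain ⟨C, hC⟩ := hb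
    have m₁ := memLp_smul_of_bounded (p := p) (μ := μ) hφ hC
      (stronglyMeasurable_const (b := v)) (fun _ => le_rfl)
    have h3 : h.toLp _ = c • m₁.toLp _ := by
      rw [← MemLp.toLp_const_smul]
      exact MemLp.toLp_congr _ _ (Eventually.of_forall fun t => smul_comm (φ t) c v)
    rw [h3, map_smul, hg.apply_eq φ hφ ⟨C, hC⟩ m₁, smul_eq_mul, ← integral_const_mul]
    exact integral_congr_ae (Eventually.of_forall fun t => by ring)

theorem IsDensity.sum {Λ : Lp E p μ →L[ℝ] ℝ} {v : ℕ → E} {g : ℕ → α → ℝ}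
    (hg : ∀ k, IsDensity Λ (v k) (g k)) (s : Finset ℕ) (c : ℕ → ℝ) :
    IsDensity Λ (∑ k ∈ s, c k • v k) (fun t => ∑ k ∈ s, c k * g k t) := by
  classical
  induction s using Finset.induction_on with
  | empty => simpa using IsDensity.zero Λ
  | insert a s ha ih =>
    simp_rw [Finset.sum_insert ha]
    exact ((hg a).smul (c a)).add ih

end BochnerDual

/-! ### Integrable domination of countably many densities -/

section BochnerDual

variable {α E : Type*} [MeasurableSpace α] {μ : Measure α} [IsFiniteMeasure μ]
  [NormedAddCommGroup E] [NormedSpace ℝ E] {p q : ℝ≥0∞} [Fact (1 ≤ p)]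

/-- The maximum of `0` and of the first `N` functions of a sequence. -/
def runningMax (g : ℕ → α → ℝ) : ℕ → α → ℝ
  | 0 => fun _ => 0
  | N + 1 => fun t => max (runningMax g N t) (g N t)

theorem runningMax_mono (g : ℕ → α → ℝ) (t : α) : Monotone fun N => runningMax g N t :=
  monotone_nat_of_le_succ fun _ => le_max_left _ _

theorem runningMax_nonneg (g : ℕ → α → ℝ) (N : ℕ) (t : α) : 0 ≤ runningMax g N t :=
  runningMax_mono g t N.zero_le

theorem le_runningMax (g : ℕ → α → ℝ) {k N : ℕ} (h : k < N) (t : α) : g k t ≤ runningMax g N t :=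
  (le_max_right _ _).trans (runningMax_mono g t (Nat.succ_le_of_lt h))

theorem measurable_runningMax {g : ℕ → α → ℝ} (hg : ∀ k, Measurable (g k)) (N : ℕ) :
    Measurable (runningMax g N) := by
  induction N with
  | zero => exact measurable_const
  | succ N ih => exact ih.max (hg N)

theorem integrable_runningMax {g : ℕ → α → ℝ} (hg : ∀ k, Integrable (g k) μ) (N : ℕ) :
    Integrable (runningMax g N) μ := by
  induction N with
  | zero => exact integrable_zero _ _ _
  | succ N ih => exact ih.sup (hg N)

/-- The pointwise maximum of the densities is itself the density of one function with values in the
unit ball: wherever `g N` exceeds the previous maximum, the selection switches to `x N`. The initial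
maximum `0` belongs to the zero vector. -/
theorem exists_selection {Λ : Lp E p μ →L[ℝ] ℝ} {x : ℕ → E} (hx : ∀ k, ‖x k‖ ≤ 1)
    {g : ℕ → α → ℝ} (hg : ∀ k, IsDensity Λ (x k) (g k)) (N : ℕ) :
    ∃ u : α → E, StronglyMeasurable u ∧ (∀ t, ‖u t‖ ≤ 1) ∧
      ∀ φ : α → ℝ, Measurable φ → (∃ C, ∀ t, |φ t| ≤ C) →
        ∀ h : MemLp (fun t => φ t • u t) p μ, Λ (h.toLp _) = ∫ t, φ t * runningMax g N t ∂μ := by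
  classical
  induction N with
  | zero =>
    refine ⟨fun _ => 0, stronglyMeasurable_const, by simp, fun φ hφ hC h => ?_⟩
    rw [(IsDensity.zero Λ).apply_eq φ hφ hC h]
    rfl
  | succ N ih =>
    obtain ⟨u, hu, hu1, hu2⟩ := ih
    have hD := measurable_runningMax (fun k => (hg k).measurable) N
    have hDi := integrable_runningMax (fun k => (hg k).integrable) N
    let A : Set α := {t | runningMax g N t < g N t}
    have hA : MeasurableSet A := measurableSet_lt hD (hg N).measurable
    refine ⟨A.piecewise (fun _ => x N) u, stronglyMeasurable_const.piecewise hA hu, fun t => ?_,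
      fun φ hφ ⟨C, hC⟩ h => ?_⟩
    · by_cases ht : t ∈ A
      · simpa [ht] using hx N
      · simpa [ht] using hu1 t
    · have hφ1 := hφ.indicator hA
      have hφ2 := hφ.indicator hA.compl
      have hC' : ∀ (B : Set α) t, |B.indicator φ t| ≤ C := fun B t => by
        by_cases ht : t ∈ B
        · simpa [ht] using hC t
        · simpa [ht] using (abs_nonneg _).trans (hC t)
      have m₁ := memLp_smul_of_bounded (p := p) (μ := μ) hφ1 (hC' A)
        (stronglyMeasurable_const (b := x N)) (fun _ => le_rfl)
      have m₂ := memLp_smul_of_bounded (p := p) (μ := μ) hφ2 (hC' Aᶜ) hu hu1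
      have h3 : h.toLp _ = m₁.toLp _ + m₂.toLp _ := by
        rw [← MemLp.toLp_add]
        refine MemLp.toLp_congr _ _ (Eventually.of_forall fun t => ?_)
        by_cases ht : t ∈ A <;> simp [ht]
      rw [h3, map_add, (hg N).apply_eq _ hφ1 ⟨C, hC' A⟩ m₁, hu2 _ hφ2 ⟨C, hC' Aᶜ⟩ m₂,
        ← integral_add (integrable_bdd_mul hφ1 (hC' A) (hg N).integrable)
          (integrable_bdd_mul hφ2 (hC' Aᶜ) hDi)]
      refine integral_congr_ae (Eventually.of_forall fun t => ?_)
      by_cases ht : t ∈ A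
      · have : runningMax g (N + 1) t = g N t := max_eq_right (le_of_lt ht)
        simp [ht, this]
      · have : runningMax g (N + 1) t = runningMax g N t := max_eq_left (not_lt.1 ht)
        simp [ht, this]

/-- With `w` the truncated maximum, `u` the selection and `I = ∫ w^Q`, testing `Λ` on `w^(Q-1) u`
gives `I ≤ ‖Λ‖ I^(1/P)`, because `(Q-1)P = Q`. Truncation at `M` keeps `I` finite, so dividing
yields `I^(1/Q) ≤ ‖Λ‖`, a bound free of `N` and `M`. -/
theorem integral_min_runningMax_rpow_le (hp : p ≠ ⊤)
    (hpq : p.toReal.HolderConjugate q.toReal) {Λ : Lp E p μ →L[ℝ] ℝ} {x : ℕ → E}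
    (hx : ∀ k, ‖x k‖ ≤ 1) {g : ℕ → α → ℝ} (hg : ∀ k, IsDensity Λ (x k) (g k)) (N M : ℕ) :
    Integrable (fun t => min (runningMax g N t) M ^ q.toReal) μ ∧
    ∫ t, min (runningMax g N t) M ^ q.toReal ∂μ ≤ ‖Λ‖ ^ q.toReal := by
  obtain ⟨u, hu, hu1, hu2⟩ := exists_selection hx hg N
  have hD := measurable_runningMax (fun k => (hg k).measurable) N
  have hDi := integrable_runningMax (fun k => (hg k).integrable) N
  set P := p.toReal
  set Q := q.toReal
  have hP := hpq.pos
  have hQ := hpq.symm.pos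
  have hQ1 : 0 ≤ Q - 1 := hpq.symm.sub_one_pos.le
  set w : α → ℝ := fun t => min (runningMax g N t) M with hw
  have hw0 : ∀ t, 0 ≤ w t := fun t => le_min (runningMax_nonneg g N t) M.cast_nonneg
  have hwm : Measurable w := hD.min measurable_const
  have hwM : ∀ t, w t ≤ M := fun t => min_le_right _ _
  have hbd : ∀ r : ℝ, 0 ≤ r → ∀ t, |w t ^ r| ≤ (M : ℝ) ^ r := fun r hr t => by
    rw [abs_of_nonneg (Real.rpow_nonneg (hw0 t) _)]
    exact Real.rpow_le_rpow (hw0 t) (hwM t) hr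
  have hint : ∀ r : ℝ, 0 ≤ r → Integrable (fun t => w t ^ r) μ := fun r hr =>
    Integrable.of_bound (hwm.pow_const r).aestronglyMeasurable _ (Eventually.of_forall (hbd r hr))
  refine ⟨hint Q hQ.le, ?_⟩
  change ∫ t, w t ^ Q ∂μ ≤ _
  have hφm : Measurable fun t => w t ^ (Q - 1) := hwm.pow_const _
  have hmem := memLp_smul_of_bounded (p := p) (μ := μ) hφm (hbd _ hQ1) hu hu1
  have hmemφ : MemLp (fun t => w t ^ (Q - 1)) p μ :=
    MemLp.of_bound hφm.aestronglyMeasurable _ (Eventually.of_forall (hbd _ hQ1))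
  set I := ∫ t, w t ^ Q ∂μ
  have hI0 : 0 ≤ I := integral_nonneg fun t => Real.rpow_nonneg (hw0 t) _
  have hnorm : ‖hmem.toLp _‖ ≤ I ^ P⁻¹ := by
    rw [Lp.norm_toLp]
    have h1 : eLpNorm (fun t => w t ^ (Q - 1) • u t) p μ ≤
        eLpNorm (fun t => w t ^ (Q - 1)) p μ := by
      refine eLpNorm_mono fun t => ?_
      rw [norm_smul]
      exact mul_le_of_le_one_right (norm_nonneg _) (hu1 t)
    refine (ENNReal.toReal_mono hmemφ.2.ne h1).trans_eq ?_
    rw [hmemφ.eLpNorm_eq_integral_rpow_norm (zero_lt_one.trans_le Fact.out).ne' hp,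
      ENNReal.toReal_ofReal (Real.rpow_nonneg (integral_nonneg fun t =>
        Real.rpow_nonneg (norm_nonneg _) _) _)]
    congr 1
    refine integral_congr_ae (Eventually.of_forall fun t => ?_)
    simp only
    rw [Real.norm_of_nonneg (Real.rpow_nonneg (hw0 t) _), ← Real.rpow_mul (hw0 t),
      hpq.symm.sub_one_mul_conj]
  have hle : I ≤ ‖Λ‖ * I ^ P⁻¹ := by
    calc I ≤ ∫ t, w t ^ (Q - 1) * runningMax g N t ∂μ := by
          refine integral_mono (hint Q hQ.le) (integrable_bdd_mul hφm (hbd _ hQ1) hDi) fun t => ?_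
          have h1 : w t ^ Q = w t ^ (Q - 1) * w t := by
            rw [← Real.rpow_add_one' (hw0 t) (by simpa using hQ.ne'), sub_add_cancel]
          simp only [h1]
          exact mul_le_mul_of_nonneg_left (min_le_left _ _) (Real.rpow_nonneg (hw0 t) _)
      _ = Λ (hmem.toLp _) := (hu2 _ hφm ⟨_, hbd _ hQ1⟩ hmem).symm
      _ ≤ ‖Λ‖ * ‖hmem.toLp _‖ := (le_abs_self _).trans (Λ.le_opNorm _)
      _ ≤ _ := mul_le_mul_of_nonneg_left hnorm (norm_nonneg _)
  rcases hI0.eq_or_lt with h0 | h0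
  · rw [← h0]
    positivity
  · have h1 : I ^ Q⁻¹ ≤ ‖Λ‖ := by
      have h2 : I = I ^ Q⁻¹ * I ^ P⁻¹ := by
        rw [← Real.rpow_add h0, add_comm, hpq.inv_add_inv_eq_one, Real.rpow_one]
      exact le_of_mul_le_mul_right (h2.symm.le.trans hle) (Real.rpow_pos_of_pos h0 _)
    calc I = (I ^ Q⁻¹) ^ Q := by rw [← Real.rpow_mul hI0, inv_mul_cancel₀ hQ.ne', Real.rpow_one]
      _ ≤ _ := Real.rpow_le_rpow (Real.rpow_nonneg hI0 _) h1 hQ.le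

/-- Truncating the `N`-th maximum at height `N` produces a single increasing sequence, and monotone
convergence carries the uniform bound to its supremum. -/
theorem exists_dominating_density (hp : p ≠ ⊤) (hq : q ≠ ⊤)
    (hpq : p.toReal.HolderConjugate q.toReal) {Λ : Lp E p μ →L[ℝ] ℝ} {x : ℕ → E}
    (hx : ∀ k, ‖x k‖ ≤ 1) {g : ℕ → α → ℝ} (hg : ∀ k, IsDensity Λ (x k) (g k)) :
    ∃ h : α → ℝ, MemLp h q μ ∧ ∀ᵐ t ∂μ, ∀ k, g k t ≤ h t := by
  set Q := q.toReal
  have hQ : 0 < Q := hpq.symm.pos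
  let w : ℕ → α → ℝ≥0∞ := fun N t => ENNReal.ofReal (min (runningMax g N t) N ^ Q)
  have hwm : ∀ N, Measurable (w N) := fun N =>
    (((measurable_runningMax (fun k => (hg k).measurable) N).min
      measurable_const).pow_const Q).ennreal_ofReal
  have hw0 : ∀ N t, 0 ≤ min (runningMax g N t) N := fun N t =>
    le_min (runningMax_nonneg g N t) N.cast_nonneg
  have hmono : Monotone w := fun N N' h t => ENNReal.ofReal_le_ofReal
    (Real.rpow_le_rpow (hw0 N t)
      (min_le_min (runningMax_mono g t h) (Nat.cast_le.2 h)) hQ.le)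
  let H : α → ℝ≥0∞ := fun t => ⨆ N, w N t
  have hHm : Measurable H := Measurable.iSup hwm
  have hHint : ∫⁻ t, H t ∂μ ≤ ENNReal.ofReal (‖Λ‖ ^ Q) := by
    rw [lintegral_iSup hwm hmono]
    refine iSup_le fun N => ?_
    obtain ⟨h1, h2⟩ := integral_min_runningMax_rpow_le hp hpq hx hg N N
    rw [← ofReal_integral_eq_lintegral_ofReal h1
      (Eventually.of_forall fun t => Real.rpow_nonneg (hw0 N t) _)]
    exact ENNReal.ofReal_le_ofReal h2
  have hHfin : ∀ᵐ t ∂μ, H t < ⊤ :=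
    ae_lt_top hHm (hHint.trans_lt ENNReal.ofReal_lt_top).ne
  refine ⟨fun t => (H t).toReal ^ Q⁻¹, ?_, ?_⟩
  · refine ⟨(hHm.ennreal_toReal.pow_const _).aestronglyMeasurable, ?_⟩
    have hq0 : q ≠ 0 := by
      rintro rfl
      simp [Q] at hQ
    rw [eLpNorm_lt_top_iff_lintegral_rpow_enorm_lt_top hq0 hq]
    refine lt_of_le_of_lt (lintegral_mono_ae ?_) (hHint.trans_lt ENNReal.ofReal_lt_top)
    filter_upwards [hHfin] with t ht
    rw [Real.enorm_eq_ofReal (by positivity), ENNReal.ofReal_rpow_of_nonneg (by positivity)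
      hQ.le, ← Real.rpow_mul (by positivity), inv_mul_cancel₀ hQ.ne', Real.rpow_one,
      ENNReal.ofReal_toReal ht.ne]
  · filter_upwards [hHfin] with t ht k
    rcases le_or_gt (g k t) 0 with hk | hk
    · exact hk.trans (by positivity)
    -- `N` must exceed the index, so that `g k` takes part in the maximum, and the value, so that
    -- the truncation does not cut it.
    obtain ⟨N, hN⟩ := exists_nat_gt (max (g k t) k)
    have hkN : k < N := by exact_mod_cast (le_max_right _ _).trans_lt hN
    have h1 : g k t ≤ min (runningMax g N t) N :=
      le_min (le_runningMax g hkN t) ((le_max_left _ _).trans hN.le)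
    have h2 : min (runningMax g N t) N ^ Q ≤ (H t).toReal := by
      rw [← ENNReal.ofReal_le_iff_le_toReal ht.ne]
      exact le_iSup (fun N => w N t) N
    calc g k t = (g k t ^ Q) ^ Q⁻¹ := by
          rw [← Real.rpow_mul hk.le, mul_inv_cancel₀ hQ.ne', Real.rpow_one]
      _ ≤ _ := Real.rpow_le_rpow (by positivity)
        ((Real.rpow_le_rpow hk.le h1 hQ.le).trans h2) (by positivity)

end BochnerDual

/-- Closed balls are convenient for values in a dual space: membership is a family of inequalities,
one for each vector of a dense sequence. -/
theorem measurable_of_closedBall {α F : Type*} [MeasurableSpace α] [PseudoMetricSpace F]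
    [TopologicalSpace.SeparableSpace F] [MeasurableSpace F] [BorelSpace F] {f : α → F}
    (h : ∀ a, ∀ r, 0 ≤ r → MeasurableSet (f ⁻¹' Metric.closedBall a r)) : Measurable f := by
  have hball : ∀ a r, MeasurableSet (f ⁻¹' Metric.ball a r) := by
    intro a r
    have hd : Measurable fun t => dist (f t) a := by
      refine measurable_of_Iic fun r => ?_
      rcases le_or_gt 0 r with hr | hr
      · exact h a r hr
      · convert MeasurableSet.empty
        refine eq_empty_of_forall_notMem fun t ht => ?_
        exact (dist_nonneg.trans_lt (lt_of_le_of_lt (mem_Iic.1 ht) hr)).false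
    exact measurableSet_lt hd measurable_const
  have : SecondCountableTopology F := UniformSpace.secondCountable_of_separable F
  refine measurable_of_isOpen fun U hU => ?_
  choose! r hr0 hr using fun a (ha : a ∈ U) => Metric.isOpen_iff.1 hU a ha
  obtain ⟨S, hSU, hS, hSeq⟩ := TopologicalSpace.isOpen_biUnion_countable U
    (fun a : F => Metric.ball a (r a)) (fun a _ => Metric.isOpen_ball)
  have hUeq : U = ⋃ a ∈ S, Metric.ball a (r a) := by
    rw [hSeq]
    exact subset_antisymm (fun a ha => mem_iUnion₂.2 ⟨a, ha, Metric.mem_ball_self (hr0 a ha)⟩)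
      (iUnion₂_subset hr)
  rw [hUeq, preimage_iUnion₂]
  exact MeasurableSet.biUnion hS fun a _ => hball a _

/-- A bound for all rational combinations of vectors with rational norm gives the bound for all
real combinations. -/
theorem linearCombination_le_of_rat {E : Type*} [NormedAddCommGroup E] [NormedSpace ℝ E]
    {v : ℕ → E} {a : ℕ → ℝ} {h : ℝ}
    (H : ∀ c : ℕ →₀ ℚ, ‖∑ k ∈ c.support, (c k : ℝ) • v k‖ ≤ 1 →
      ∑ k ∈ c.support, (c k : ℝ) * a k ≤ h) (c : ℕ →₀ ℝ) :
    Finsupp.linearCombination ℝ a c ≤ h * ‖Finsupp.linearCombination ℝ v c‖ := by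
  classical
  have hseq : ∀ x : ℝ, ∃ s : ℕ → ℚ, Tendsto (fun n => (s n : ℝ)) atTop (𝓝 x) := fun x => by
    obtain ⟨u, hu, hux⟩ := mem_closure_iff_seq_limit.1 (Rat.denseRange_cast (𝕜 := ℝ) x)
    choose s hs using hu
    exact ⟨s, by simpa only [hs] using hux⟩
  choose s hs using hseq
  -- The strict inequality is an open condition, so rational approximations of the coefficients
  -- eventually satisfy the hypothesis of `H`.
  have step : ∀ c : ℕ →₀ ℝ, ‖Finsupp.linearCombination ℝ v c‖ < 1 →
      Finsupp.linearCombination ℝ a c ≤ h := by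
    intro c hc
    let r : ℕ → ℕ →₀ ℚ := fun n =>
      Finsupp.onFinset c.support (fun k => if k ∈ c.support then s (c k) n else 0) (by
        intro k hk
        by_contra hk'
        simp [hk'] at hk)
    have hr : ∀ n k, k ∈ c.support → r n k = s (c k) n := fun n k hk => by
      simp only [r, Finsupp.onFinset_apply, if_pos hk]
    have hsub : ∀ n, (r n).support ⊆ c.support := fun n => Finsupp.support_onFinset_subset
    have hv : ∀ n, ∑ k ∈ (r n).support, (r n k : ℝ) • v k =
        ∑ k ∈ c.support, (s (c k) n : ℝ) • v k := fun n => by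
      rw [Finset.sum_subset (hsub n) (fun k _ hk => by simp [Finsupp.notMem_support_iff.1 hk])]
      exact Finset.sum_congr rfl fun k hk => by rw [hr n k hk]
    have ha : ∀ n, ∑ k ∈ (r n).support, (r n k : ℝ) * a k =
        ∑ k ∈ c.support, (s (c k) n : ℝ) * a k := fun n => by
      rw [Finset.sum_subset (hsub n) (fun k _ hk => by simp [Finsupp.notMem_support_iff.1 hk])]
      exact Finset.sum_congr rfl fun k hk => by rw [hr n k hk]
    have hvlim : Tendsto (fun n => ‖∑ k ∈ (r n).support, (r n k : ℝ) • v k‖) atTop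
        (𝓝 ‖Finsupp.linearCombination ℝ v c‖) := by
      simp_rw [hv]
      exact (tendsto_finsetSum _ fun k _ => (hs (c k)).smul_const (v k)).norm
    have halim : Tendsto (fun n => ∑ k ∈ (r n).support, (r n k : ℝ) * a k) atTop
        (𝓝 (Finsupp.linearCombination ℝ a c)) := by
      simp_rw [ha]
      exact tendsto_finsetSum _ fun k _ => (hs (c k)).mul_const (a k)
    refine le_of_tendsto halim ?_
    filter_upwards [hvlim.eventually_lt_const hc] with n hn
    exact H _ hn.le
  -- Scaling by some `r` above the norm, and letting `r` decrease to it, avoids dividing by a norm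
  -- that may vanish.
  have step2 : ∀ r : ℝ, ‖Finsupp.linearCombination ℝ v c‖ < r →
      Finsupp.linearCombination ℝ a c ≤ h * r := by
    intro r hr
    have hr0 : 0 < r := (norm_nonneg _).trans_lt hr
    have := step (r⁻¹ • c) (by
      rw [map_smul, norm_smul, norm_inv, Real.norm_of_nonneg hr0.le, inv_mul_lt_iff₀ hr0]
      simpa using hr)
    rwa [map_smul, smul_eq_mul, inv_mul_le_iff₀ hr0, mul_comm] at this
  have hlim : Tendsto (fun r : ℝ => h * r) (𝓝[>] ‖Finsupp.linearCombination ℝ v c‖)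
      (𝓝 (h * ‖Finsupp.linearCombination ℝ v c‖)) :=
    (continuous_const.mul continuous_id).continuousWithinAt
  exact ge_of_tendsto hlim (eventually_mem_nhdsWithin.mono fun r hr => step2 r hr)

/-! ### Representation of functionals on Bochner spaces -/

section BochnerDual

variable {α E : Type*} [MeasurableSpace α] {μ : Measure α} [IsFiniteMeasure μ]
  [NormedAddCommGroup E] [NormedSpace ℝ E] {p q : ℝ≥0∞} [Fact (1 ≤ p)]

/-- At time `t` the functional should send `v k` to `g k t`. This is consistent and bounded once
linear combinations of the `g k t` are controlled by the norms of those of the `v k`. Only countably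
many rational combinations lie in the unit ball, so one `h` in `L^q` dominates all their densities
off a null set; it then bounds the norm of `G`. -/
theorem exists_dual_density [TopologicalSpace.SeparableSpace (StrongDual ℝ E)] (hp : p ≠ ⊤)
    (hq : q ≠ ⊤) (hpq : p.toReal.HolderConjugate q.toReal) (Λ : Lp E p μ →L[ℝ] ℝ) :
    ∃ (v : ℕ → E) (g : ℕ → α → ℝ) (G : α → StrongDual ℝ E), DenseRange v ∧
      (∀ k, IsDensity Λ (v k) (g k)) ∧ MemLp G q μ ∧ ∀ᵐ t ∂μ, ∀ k, G t (v k) = g k t := by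
  have : TopologicalSpace.SeparableSpace E := separableSpace_of_strongDual
  let v := TopologicalSpace.denseSeq E
  have hv : DenseRange v := TopologicalSpace.denseRange_denseSeq E
  choose g hg using fun k => exists_isDensity hp Λ (v k)
  let S := {c : ℕ →₀ ℚ // ‖∑ k ∈ c.support, (c k : ℝ) • v k‖ ≤ 1}
  have hS : Nonempty S := ⟨⟨0, by simp⟩⟩
  obtain ⟨c, hc⟩ := exists_surjective_nat S
  obtain ⟨h, hh, hgh⟩ := exists_dominating_density hp hq hpq (Λ := Λ) (fun n => (c n).2)
    (fun n => IsDensity.sum hg (c n).1.support fun k => ((c n).1 k : ℝ))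
  have hbound : ∀ᵐ t ∂μ, ∀ d : ℕ →₀ ℝ, ‖Finsupp.linearCombination ℝ (fun k => g k t) d‖ ≤
      h t * ‖Finsupp.linearCombination ℝ v d‖ := by
    filter_upwards [hgh] with t ht d
    have hle := linearCombination_le_of_rat (v := v) (a := fun k => g k t) (h := h t)
      (fun c' hc' => by
        obtain ⟨n, hn⟩ := hc ⟨c', hc'⟩
        simpa only [hn] using ht n)
    refine abs_le.2 ⟨?_, hle d⟩
    have := hle (-d)
    rw [map_neg, map_neg, norm_neg] at this
    linarith
  have hdense : DenseRange (Finsupp.linearCombination ℝ v) := hv.mono <| by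
    rintro _ ⟨k, rfl⟩
    exact ⟨Finsupp.single k 1, by simp⟩
  -- Setting `G` to zero off a measurable set of full measure makes the identity for `G t (v k)`
  -- hold at every point, as measurability requires.
  obtain ⟨s, hs, hsm, hsb⟩ := hbound.exists_measurable_mem
  let G : α → StrongDual ℝ E := s.indicator fun t =>
    (Finsupp.linearCombination ℝ fun k => g k t).extendOfNorm (Finsupp.linearCombination ℝ v)
  have hGv : ∀ t k, G t (v k) = s.indicator (g k) t := by
    intro t k
    by_cases ht : t ∈ s
    · have := LinearMap.extendOfNorm_eq hdense ⟨h t, hsb t ht⟩ (Finsupp.single k 1)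
      simpa [G, ht] using this
    · simp [G, ht]
  refine ⟨v, g, G, hv, hg, ?_, ?_⟩
  · borelize (StrongDual ℝ E)
    have hGm : Measurable G := by
      refine measurable_of_closedBall fun ℓ r hr => ?_
      have : G ⁻¹' Metric.closedBall ℓ r =
          ⋂ k, {t | |s.indicator (g k) t - ℓ (v k)| ≤ r * ‖v k‖} := by
        ext t
        simp only [mem_preimage, Metric.mem_closedBall, dist_eq_norm, mem_iInter, mem_ofPred_eq]
        simp_rw [← hGv]
        refine ⟨fun ht k => ((G t - ℓ).le_opNorm (v k)).trans
          (mul_le_mul_of_nonneg_right ht (norm_nonneg _)), fun ht => ?_⟩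
        refine ContinuousLinearMap.opNorm_le_bound _ hr fun x => ?_
        have hcl : IsClosed {x : E | ‖(G t - ℓ) x‖ ≤ r * ‖x‖} :=
          isClosed_le (G t - ℓ).continuous.norm (continuous_const.mul continuous_norm)
        exact hv.induction_on (p := fun x => ‖(G t - ℓ) x‖ ≤ r * ‖x‖) x hcl ht
      rw [this]
      refine MeasurableSet.iInter fun k => measurableSet_le ?_ measurable_const
      exact ((hg k).measurable.indicator hsm |>.sub_const _).abs
    refine hh.mono hGm.stronglyMeasurable.aestronglyMeasurable ?_
    filter_upwards [hs] with t ht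
    -- A negative `h t` contradicts the bound at any nonzero combination, and such combinations
    -- exist unless `E` is trivial.
    have h0 : 0 ≤ h t ∨ Subsingleton E := by
      by_contra! hcon
      obtain ⟨h1, h2⟩ := hcon
      obtain ⟨x, hx⟩ := exists_ne (0 : E)
      obtain ⟨d, hd⟩ := hdense.exists_mem_open (isOpen_compl_singleton (x := (0 : E))) ⟨x, hx⟩
      have h3 := hsb t ht d
      have h4 := norm_pos_iff.2 hd
      have h5 := mul_neg_of_neg_of_pos h1 h4
      linarith [norm_nonneg (Finsupp.linearCombination ℝ (fun k => g k t) d)]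
    rcases h0 with h0 | h0
    · rw [Real.norm_of_nonneg h0]
      refine ContinuousLinearMap.opNorm_le_bound _ h0 fun x => ?_
      have := LinearMap.norm_extendOfNorm_apply_le hdense (h t) (hsb t ht) x
      simpa [G, ht] using this
    · have : G t = 0 := by
        ext x
        rw [Subsingleton.elim x 0, map_zero, map_zero]
      rw [this, norm_zero]
      exact norm_nonneg _
  · filter_upwards [hs] with t ht k
    rw [hGv, indicator_of_mem ht]

theorem exists_dual_representation [TopologicalSpace.SeparableSpace (StrongDual ℝ E)]
    [Fact (1 ≤ q)] [q.HolderConjugate p] (hp : p ≠ ⊤) (hq : q ≠ ⊤) (Λ : Lp E p μ →L[ℝ] ℝ) :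
    ∃ G : Lp (StrongDual ℝ E) q μ,
      ContinuousLinearMap.lpPairing μ q p (ContinuousLinearMap.id ℝ (StrongDual ℝ E)) G = Λ := by
  obtain ⟨v, g, G, hv, hg, hG, hGg⟩ := exists_dual_density hp hq
    (ENNReal.HolderConjugate.toReal_of_ne_top (p := q) (q := p) hq hp).symm Λ
  refine ⟨hG.toLp G, ?_⟩
  set Γ := ContinuousLinearMap.lpPairing μ q p (ContinuousLinearMap.id ℝ (StrongDual ℝ E))
    (hG.toLp G)
  have hΓ : ∀ u : Lp E p μ, Γ u = ∫ t, G t (u t) ∂μ := fun u => by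
    rw [ContinuousLinearMap.lpPairing_eq_integral]
    refine integral_congr_ae ?_
    filter_upwards [hG.coeFn_toLp] with t ht
    simp [ht]
  let B : E →L[ℝ] ℝ →L[ℝ] E := (ContinuousLinearMap.lsmul ℝ ℝ).flip
  have hB : ∀ (c : E) (φ : Lp ℝ p μ), B.compLpL₂ p μ c φ =ᵐ[μ] fun t => φ t • c := fun c φ => by
    rw [ContinuousLinearMap.compLpL₂_apply_apply]
    filter_upwards [(B c).coeFn_compLp φ] with t ht
    rw [ht]
    rfl
  have key : ∀ (c : E) {s : Set α} (hs : MeasurableSet s),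
      Γ (indicatorConstLp p hs (measure_ne_top μ s) c) =
        Λ (indicatorConstLp p hs (measure_ne_top μ s) c) := by
    intro c s hs
    let φ := indicatorConstLp p hs (measure_ne_top μ s) (1 : ℝ)
    have hind : ∀ c : E, indicatorConstLp p hs (measure_ne_top μ s) c = B.compLpL₂ p μ c φ := by
      intro c
      refine Lp.ext ?_
      filter_upwards [hB c φ, indicatorConstLp_coeFn (p := p) (μ := μ) (hs := hs)
        (hμs := measure_ne_top μ s) (c := c), indicatorConstLp_coeFn (p := p) (μ := μ) (hs := hs)
        (hμs := measure_ne_top μ s) (c := (1 : ℝ))] with t h1 h2 h3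
      rw [h1, h2, h3]
      by_cases ht : t ∈ s <;> simp [ht]
    have hcont : ∀ Ξ : Lp E p μ →L[ℝ] ℝ, Continuous fun c => Ξ (B.compLpL₂ p μ c φ) := fun Ξ =>
      Ξ.continuous.comp ((B.compLpL₂ p μ).flip φ).continuous
    rw [hind]
    -- Both functionals are continuous in the value `c` of the indicator, so only the values `v k`,
    -- where the densities are known, need checking.
    refine congrFun (hv.equalizer (hcont Γ) (hcont Λ) (funext fun k => ?_)) c
    simp only [Function.comp]
    rw [← hind, hΓ]
    have hφm : Measurable (s.indicator fun _ => (1 : ℝ)) := measurable_const.indicator hs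
    have hφb : ∀ t, |s.indicator (fun _ => (1 : ℝ)) t| ≤ 1 := fun t => by
      by_cases ht : t ∈ s <;> simp [ht]
    have hm := memLp_smul_of_bounded (p := p) (μ := μ) hφm hφb
      (stronglyMeasurable_const (b := v k)) (fun _ => le_rfl)
    have e1 : indicatorConstLp p hs (measure_ne_top μ s) (v k) = hm.toLp _ := by
      rw [indicatorConstLp]
      refine MemLp.toLp_congr _ _ (Eventually.of_forall fun t => ?_)
      by_cases ht : t ∈ s <;> simp [ht]
    have e2 := (hg k).apply_eq _ hφm ⟨1, hφb⟩ hm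
    rw [e1, e2]
    refine integral_congr_ae ?_
    filter_upwards [hm.coeFn_toLp, hGg] with t h1 h2
    rw [h1, map_smul, h2, smul_eq_mul]
  refine ContinuousLinearMap.ext fun u => ?_
  refine Lp.induction hp (fun u => Γ u = Λ u) (fun c s hs hμs => ?_) ?_
    (isClosed_eq Γ.continuous Λ.continuous) u
  · rw [Lp.simpleFunc.coe_indicatorConst]
    exact key c hs
  · intro f g hf hg _ h1 h2
    rw [map_add, map_add, h1, h2]

end BochnerDual

/-! ### Weak sequential compactness of Bochner spaces and of the state space -/

section BochnerReflexive

variable {α E : Type*} [MeasurableSpace α] {μ : Measure α} [IsFiniteMeasure μ]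
  [NormedAddCommGroup E] [NormedSpace ℝ E] {p q : ℝ≥0∞} [Fact (1 ≤ p)]

/-- Pulled back to `L^q(E*)`, a bidual element `Φ` is represented by a function in `L^p(E**)`.
Applying the inverse of the canonical isometry pointwise turns it into an element of `L^p(E)`. -/
theorem isReflexiveSpace_Lp [TopologicalSpace.SeparableSpace E] (hE : IsReflexiveSpace E)
    [Fact (1 ≤ q)] [q.HolderConjugate p] [p.HolderConjugate q] (hp : p ≠ ⊤) (hq : q ≠ ⊤) :
    IsReflexiveSpace (Lp E p μ) := by
  have := hE.separableSpace_dual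
  have := hE.separableSpace_bidual
  intro Φ
  obtain ⟨G, hG⟩ := exists_dual_representation (E := StrongDual ℝ E) (p := q) (q := p) hq hp
    (Φ.comp (ContinuousLinearMap.lpPairing μ q p (ContinuousLinearMap.id ℝ (StrongDual ℝ E))))
  refine ⟨(hE.equiv.symm.toContinuousLinearEquiv :
    StrongDual ℝ (StrongDual ℝ E) →L[ℝ] E).compLp G, ?_⟩
  ext Λ
  obtain ⟨g, rfl⟩ := exists_dual_representation (q := q) hp hq Λ
  have h1 := DFunLike.congr_fun hG g
  rw [ContinuousLinearMap.comp_apply] at h1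
  rw [← h1, NormedSpace.dual_def, ContinuousLinearMap.lpPairing_eq_integral,
    ContinuousLinearMap.lpPairing_eq_integral]
  refine integral_congr_ae ?_
  filter_upwards [(hE.equiv.symm.toContinuousLinearEquiv :
    StrongDual ℝ (StrongDual ℝ E) →L[ℝ] E).coeFn_compLp G] with t ht
  rw [ht]
  change g t (hE.equiv.symm (G t)) = G t (g t)
  rw [← hE.equiv_apply, LinearIsometryEquiv.apply_symm_apply]

/-- The dual is a continuous image of the separable space `L^q(E*)`, hence separable, as the
compactness theorem for reflexive spaces demands. -/
theorem weaklySeqCompact_Lp [IsSeparable μ] [TopologicalSpace.SeparableSpace E]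
    (hE : IsReflexiveSpace E) (hp1 : 1 < p) (hp : p ≠ ⊤) : WeaklySeqCompact (Lp E p μ) := by
  have h1 : p.HolderConjugate p.conjExponent := ENNReal.HolderConjugate.conjExponent hp1.le
  have h2 : p.conjExponent.HolderConjugate p := h1.symm
  have hq : p.conjExponent ≠ ⊤ := by
    have := tsub_pos_iff_lt.2 hp1
    simp [ENNReal.conjExponent, this.ne']
  have hq1 : Fact (1 ≤ p.conjExponent) := ⟨by simp [ENNReal.conjExponent]⟩
  have hq2 : Fact (p.conjExponent ≠ ⊤) := ⟨hq⟩
  have := hE.separableSpace_dual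
  have hsurj : Function.Surjective (ContinuousLinearMap.lpPairing μ p.conjExponent p
      (ContinuousLinearMap.id ℝ (StrongDual ℝ E))) := exists_dual_representation hp hq
  have : TopologicalSpace.SeparableSpace (StrongDual ℝ (Lp E p μ)) :=
    hsurj.denseRange.separableSpace (ContinuousLinearMap.continuous _)
  exact (isReflexiveSpace_Lp hE hp hq).weaklySeqCompact

/-- Hölder's inequality makes weighted time integrals bounded operators. This closes the weak
derivative relation under limits and lets weak convergence pass to averages over subintervals. -/
theorem exists_integral_smul_clm [CompleteSpace E] {ψ : α → ℝ} (hψ : AEStronglyMeasurable ψ μ)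
    {C : ℝ} (hC : ∀ t, |ψ t| ≤ C) :
    ∃ S : Lp E p μ →L[ℝ] E, ∀ u : Lp E p μ, S u = ∫ t, ψ t • u t ∂μ := by
  have h1 : p.HolderConjugate p.conjExponent := ENNReal.HolderConjugate.conjExponent Fact.out
  have h2 : p.conjExponent.HolderConjugate p := h1.symm
  have hq1 : Fact (1 ≤ p.conjExponent) := ⟨by simp [ENNReal.conjExponent]⟩
  have hm : MemLp ψ p.conjExponent μ := MemLp.of_bound hψ C (Eventually.of_forall hC)
  refine ⟨ContinuousLinearMap.lpPairing μ p.conjExponent p (ContinuousLinearMap.lsmul ℝ ℝ)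
    (hm.toLp ψ), fun u => ?_⟩
  rw [ContinuousLinearMap.lpPairing_eq_integral]
  refine integral_congr_ae ?_
  filter_upwards [hm.coeFn_toLp] with t ht
  rw [ht]
  rfl

end BochnerReflexive

theorem WeaklySeqCompact.withLpProd {E F : Type*} [NormedAddCommGroup E] [NormedSpace ℝ E]
    [NormedAddCommGroup F] [NormedSpace ℝ F] (h : WeaklySeqCompact E) (h' : WeaklySeqCompact F) :
    WeaklySeqCompact (WithLp 1 (E × F)) :=
  (h.prod h').of_equiv (WithLp.prodContinuousLinearEquiv 1 ℝ E F).symm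

section StateSpaceCompact

variable {V V' : Type*} [NormedAddCommGroup V] [NormedSpace ℝ V]
  [NormedAddCommGroup V'] [NormedSpace ℝ V'] {p : ℝ≥0∞} [Fact (1 ≤ p)] {T : ℝ}

theorem isClosed_sobolevBochner [CompleteSpace V'] :
    IsClosed (SobolevBochner V' p T : Set (WithLp 1 (Lp V' p (volume.restrict (Ioo 0 T)) ×
      Lp V' p (volume.restrict (Ioo 0 T))))) := by
  have hset : (SobolevBochner V' p T : Set (WithLp 1 (Lp V' p (volume.restrict (Ioo 0 T)) ×
      Lp V' p (volume.restrict (Ioo 0 T))))) =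
      ⋂ (φ : ℝ → ℝ) (_ : ContDiff ℝ ∞ φ) (_ : HasCompactSupport φ) (_ : tsupport φ ⊆ Ioo 0 T),
        {u | ∫ t in Ioo 0 T, deriv φ t • u.fst t = -∫ t in Ioo 0 T, φ t • u.snd t} := by
    ext u
    simp only [mem_iInter]
    rfl
  rw [hset]
  refine isClosed_iInter fun φ => isClosed_iInter fun h1 => isClosed_iInter fun h2 =>
    isClosed_iInter fun _ => ?_
  have hd : Continuous (deriv φ) := h1.continuous_deriv (by simp)
  obtain ⟨C, hC⟩ := h2.exists_bound_of_continuous h1.continuous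
  obtain ⟨D, hD⟩ := h2.deriv.exists_bound_of_continuous hd
  obtain ⟨S₁, hS₁⟩ := exists_integral_smul_clm (E := V') (p := p) (μ := volume.restrict (Ioo 0 T))
    hd.aestronglyMeasurable hD
  obtain ⟨S₂, hS₂⟩ := exists_integral_smul_clm (E := V') (p := p) (μ := volume.restrict (Ioo 0 T))
    h1.continuous.aestronglyMeasurable hC
  simp_rw [← hS₁, ← hS₂]
  exact isClosed_eq (S₁.continuous.comp (WithLp.continuous_fst 1 _ _))
    (S₂.continuous.comp (WithLp.continuous_snd 1 _ _)).neg

theorem isClosed_stateSpace (ι : V →L[ℝ] V') :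
    IsClosed (StateSpace ι p T : Set (WithLp 1 (Lp V p (volume.restrict (Ioo 0 T)) ×
      SobolevBochner V' p T))) := by
  refine isClosed_eq (f := fun u : WithLp 1 (Lp V p (volume.restrict (Ioo 0 T)) ×
      SobolevBochner V' p T) => (u.snd : WithLp 1 (Lp V' p (volume.restrict (Ioo 0 T)) ×
    Lp V' p (volume.restrict (Ioo 0 T)))).fst)
    (g := fun u => ι.compLpL p (volume.restrict (Ioo 0 T)) u.fst) ?_ ?_
  · exact (WithLp.continuous_fst 1 _ _).comp
      (continuous_subtype_val.comp (WithLp.continuous_snd 1 _ _))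
  · exact (ContinuousLinearMap.continuous _).comp (WithLp.continuous_fst 1 _ _)

theorem weaklySeqCompact_stateSpace [CompleteSpace V'] [TopologicalSpace.SeparableSpace V]
    [TopologicalSpace.SeparableSpace V'] (hV : IsReflexiveSpace V) (hV' : IsReflexiveSpace V')
    (hp1 : 1 < p) (hp : p ≠ ⊤) (ι : V →L[ℝ] V') : WeaklySeqCompact (StateSpace ι p T) := by
  have h1 : WeaklySeqCompact (Lp V p (volume.restrict (Ioo 0 T))) := weaklySeqCompact_Lp hV hp1 hp
  have h2 : WeaklySeqCompact (Lp V' p (volume.restrict (Ioo 0 T))) :=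
    weaklySeqCompact_Lp hV' hp1 hp
  have h3 : WeaklySeqCompact (SobolevBochner V' p T) :=
    (h2.withLpProd h2).submodule isClosed_sobolevBochner
  exact (h1.withLpProd h3).submodule (isClosed_stateSpace ι)

end StateSpaceCompact

/-! ### Continuity of symbolic networks -/

theorem continuous_polyEval {n d : ℕ} :
    Continuous fun z : (MultiIdx n d → ℝ) × (Fin n → ℝ) => polyEval z.1 z.2 := by
  unfold polyEval
  fun_prop

namespace SymbolicArchitecture

variable {A : SymbolicArchitecture} {ε : ℝ}

theorem isClosed_normalizedDenominators (ε : ℝ) (d n : ℕ) :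
    IsClosed (normalizedDenominators ε d n) := by
  have hset : normalizedDenominators ε d n =
      (⋂ x : Fin n → ℝ, {b | ε ≤ polyEval b x}) ∩ {b | √(∑ k, b k ^ 2) = 1} := by
    ext b
    simp [normalizedDenominators]
  rw [hset]
  refine (isClosed_iInter fun x => isClosed_le continuous_const ?_).inter
    (isClosed_eq (by fun_prop) continuous_const)
  exact continuous_polyEval.comp (continuous_id.prodMk continuous_const)

variable (A) in
theorem isClosed_paramSet (ε : ℝ) : IsClosed (A.paramSet ε) := by
  have hset : A.paramSet ε =
      (⋂ (i : Fin A.depth) (j : Fin (A.ratWidth i)), (fun θ : A.Coeff => (θ.1 i).2 j) ⁻¹'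
        normalizedDenominators ε (A.degree i) (A.actWidth i.castSucc)) ∩
      ⋂ j : Fin 1, (fun θ : A.Coeff => θ.2.2 j) ⁻¹' normalizedDenominators ε A.outDegree
        (A.actWidth (Fin.last A.depth) + A.actWidth 0) := by
    ext θ
    simp only [mem_inter_iff, mem_iInter, mem_preimage]
    rfl
  rw [hset]
  refine (isClosed_iInter fun i => isClosed_iInter fun j => ?_).inter
    (isClosed_iInter fun j => ?_)
  · exact (isClosed_normalizedDenominators _ _ _).preimage (by fun_prop)
  · exact (isClosed_normalizedDenominators _ _ _).preimage (by fun_prop)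

/-- The lower bound `ε` keeps denominators away from zero, so continuity holds jointly in
coefficients and arguments. -/
theorem continuous_ratMap {Z : Type*} [TopologicalSpace Z] {n m d : ℕ} {ε : ℝ} (hε : 0 < ε)
    {c : Z → RatCoeff n m d} {x : Z → Fin n → ℝ} (hc : Continuous c) (hx : Continuous x)
    (hden : ∀ z j, (c z).2 j ∈ normalizedDenominators ε d n) :
    Continuous fun z => ratMap (c z) (x z) := by
  refine continuous_pi fun j => Continuous.div ?_ ?_ fun z => ?_
  · exact continuous_polyEval.comp (((continuous_apply j).comp hc.fst).prodMk hx)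
  · exact continuous_polyEval.comp (((continuous_apply j).comp hc.snd).prodMk hx)
  · exact (hε.trans_le ((hden z j).1 (x z))).ne'

theorem continuous_hidden (hA : ∀ l, Continuous (A.act l)) (hε : 0 < ε)
    (i : Fin (A.depth + 1)) :
    Continuous fun z : A.paramSet ε × (Fin (A.actWidth 0) → ℝ) => hidden z.1.1 z.2 i := by
  induction i using Fin.induction with
  | zero => exact continuous_snd
  | succ i ih =>
    refine (hA i).comp (continuous_ratMap hε (c := fun z : A.paramSet ε × _ => z.1.1.1 i)
      ?_ ih fun z j => z.1.2.1 i j)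
    fun_prop

theorem continuous_law {d κ : ℕ} (coord : Fin (A.actWidth 0) ≃ Option (MultiIdx d κ))
    (hA : ∀ l, Continuous (A.act l)) (hε : 0 < ε) :
    Continuous fun z : (A.paramSet ε × ℝ) × (MultiIdx d κ → ℝ) =>
      law coord z.1.1.1 z.1.2 z.2 := by
  have hin : Continuous fun z : (A.paramSet ε × ℝ) × (MultiIdx d κ → ℝ) =>
      fun j => (coord j).elim z.1.2 z.2 := by
    refine continuous_pi fun j => ?_
    cases coord j with
    | none => exact continuous_fst.snd
    | some β => exact (continuous_apply β).comp continuous_snd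
  have hh := (continuous_hidden hA hε (Fin.last A.depth)).comp
    ((continuous_fst.comp continuous_fst).prodMk hin)
  have happ : Continuous fun z : (A.paramSet ε × ℝ) × (MultiIdx d κ → ℝ) =>
      Fin.append (hidden z.1.1.1 (fun j => (coord j).elim z.1.2 z.2) (Fin.last A.depth))
        (fun j => (coord j).elim z.1.2 z.2) := by
    refine continuous_pi fun k => ?_
    induction k using Fin.addCases with
    | left k =>
      simp only [Fin.append_left]
      exact (continuous_apply k).comp hh
    | right k =>
      simp only [Fin.append_right]
      exact (continuous_apply k).comp hin
  have hr := continuous_ratMap hε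
    (c := fun z : (A.paramSet ε × ℝ) × (MultiIdx d κ → ℝ) => z.1.1.1.2) (by fun_prop) happ
    (fun z j => z.1.1.2.2 j)
  exact (continuous_apply 0).comp hr

end SymbolicArchitecture

/-! ### Truncated superposition operators -/

section Superposition

variable {κ : Type*}

/-- Truncation of all components to the interval `[-M, M]`. -/
def truncate (M : ℝ) (z : κ → ℝ) : κ → ℝ := fun β => max (-M) (min M (z β))

theorem continuous_truncate (M : ℝ) : Continuous (truncate M : (κ → ℝ) → κ → ℝ) :=
  continuous_pi fun β => continuous_const.max (continuous_const.min (continuous_apply β))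

theorem truncate_eq {M : ℝ} {z : κ → ℝ} (h : ∀ β, |z β| ≤ M) : truncate M z = z :=
  funext fun β => by
    rw [truncate, min_eq_right (abs_le.1 (h β)).2, max_eq_right (abs_le.1 (h β)).1]

theorem truncate_mem {M : ℝ} (hM : 0 ≤ M) (z : κ → ℝ) :
    truncate M z ∈ Set.pi univ fun _ : κ => Icc (-M) M :=
  fun _ _ => ⟨le_max_left _ _, max_le (by linarith) (min_le_left _ _)⟩

variable {P X : Type*} [MetricSpace P] [MeasurableSpace X] {μ : Measure X} [IsFiniteMeasure μ]
  {s q : ℝ≥0∞} [Fact (1 ≤ s)] [Fact (1 ≤ q)] [Fintype κ]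

/-- Truncated arguments stay in a compact cube, whatever the growth of `f`. -/
theorem exists_bound_truncate {f : P × (κ → ℝ) → ℝ} (hf : Continuous f) {M : ℝ} (hM : 0 ≤ M)
    {S : Set P} (hS : IsCompact S) : ∃ C : ℝ, ∀ π ∈ S, ∀ z, |f (π, truncate M z)| ≤ C := by
  obtain ⟨C, hC⟩ := (hS.prod (isCompact_univ_pi fun _ : κ => isCompact_Icc (a := -M) (b := M))
    ).exists_bound_of_continuousOn hf.continuousOn
  exact ⟨C, fun π hπ z => hC _ ⟨hπ, truncate_mem hM z⟩⟩

theorem memLp_superposition {f : P × (κ → ℝ) → ℝ} (hf : Continuous f) {M : ℝ} (hM : 0 ≤ M)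
    (z : P × PiLp s fun _ : κ => Lp ℝ s μ) :
    MemLp (fun x => f (z.1, truncate M fun β => z.2 β x)) q μ := by
  obtain ⟨C, hC⟩ := exists_bound_truncate hf hM (isCompact_singleton (x := z.1))
  refine MemLp.of_bound ?_ C (Eventually.of_forall fun x => hC _ rfl _)
  have h1 : AEStronglyMeasurable (fun x => fun β => z.2 β x) μ :=
    (aemeasurable_pi_iff.2 fun β => (Lp.aestronglyMeasurable (z.2 β)).aemeasurable
      ).aestronglyMeasurable
  exact (hf.comp (continuous_const.prodMk (continuous_truncate M))).comp_aestronglyMeasurable h1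

/-- The truncated superposition operator `(π, v) ↦ f(π, truncate v)`. -/
def superposition (q : ℝ≥0∞) [Fact (1 ≤ q)] {f : P × (κ → ℝ) → ℝ} (hf : Continuous f) {M : ℝ}
    (hM : 0 ≤ M) (z : P × PiLp s fun _ : κ => Lp ℝ s μ) : Lp ℝ q μ :=
  (memLp_superposition hf hM z).toLp _

theorem exists_bound_superposition {f : P × (κ → ℝ) → ℝ} (hf : Continuous f) {M : ℝ}
    (hM : 0 ≤ M) {S : Set P} (hS : IsCompact S) :
    ∃ C : ℝ, ∀ z : P × PiLp s fun _ : κ => Lp ℝ s μ, z.1 ∈ S →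
      ‖superposition q hf hM z‖ ≤ C := by
  obtain ⟨C, hC⟩ := exists_bound_truncate hf hM hS
  refine ⟨(measureUnivNNReal μ : ℝ) ^ q.toReal⁻¹ * max C 0, fun z hz => ?_⟩
  refine Lp.norm_le_of_ae_bound (le_max_right _ _) ?_
  filter_upwards [(memLp_superposition (q := q) hf hM z).coeFn_toLp] with x hx
  rw [superposition, hx]
  exact (hC _ hz _).trans (le_max_left _ _)

theorem exists_subseq_ae_tendsto {v : ℕ → PiLp s fun _ : κ => Lp ℝ s μ}
    {a : PiLp s fun _ : κ => Lp ℝ s μ} (h : Tendsto v atTop (𝓝 a)) :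
    ∃ φ : ℕ → ℕ, StrictMono φ ∧
      ∀ᵐ x ∂μ, ∀ β, Tendsto (fun n => v (φ n) β x) atTop (𝓝 (a β x)) := by
  classical
  have hfin : ∀ S : Finset κ, ∃ φ : ℕ → ℕ, StrictMono φ ∧
      ∀ β ∈ S, ∀ᵐ x ∂μ, Tendsto (fun n => v (φ n) β x) atTop (𝓝 (a β x)) := by
    intro S
    induction S using Finset.induction_on with
    | empty => exact ⟨id, strictMono_id, by simp⟩
    | insert b S hb ih =>
      obtain ⟨φ, hφ, hS⟩ := ih
      have h1 : Tendsto (fun n => v (φ n) b) atTop (𝓝 (a b)) :=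
        ((PiLp.continuous_apply s _ b).tendsto a).comp (h.comp hφ.tendsto_atTop)
      obtain ⟨ψ, hψ, hae⟩ := (tendstoInMeasure_of_tendsto_Lp h1).exists_seq_tendsto_ae
      refine ⟨φ ∘ ψ, hφ.comp hψ, fun β hβ => ?_⟩
      rcases Finset.mem_insert.1 hβ with rfl | hβ
      · exact hae
      · filter_upwards [hS β hβ] with x hx
        exact hx.comp hψ.tendsto_atTop
  obtain ⟨φ, hφ, h2⟩ := hfin Finset.univ
  exact ⟨φ, hφ, ae_all_iff.2 fun β => h2 β (Finset.mem_univ β)⟩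

/-- A convergent sequence in `L^s` has an almost everywhere convergent subsequence. Truncation
supplies the uniform bound, so no relation between `s` and `q` is needed. -/
theorem continuous_superposition (hq : q ≠ ⊤) {f : P × (κ → ℝ) → ℝ} (hf : Continuous f) {M : ℝ}
    (hM : 0 ≤ M) :
    Continuous (superposition q hf hM : (P × PiLp s fun _ : κ => Lp ℝ s μ) → Lp ℝ q μ) := by
  refine SeqContinuous.continuous fun z a hz => ?_
  refine tendsto_of_subseq_tendsto fun ns hns => ?_
  have hz1 : Tendsto (fun n => (z (ns n)).1) atTop (𝓝 a.1) :=
    (continuous_fst.tendsto a).comp (hz.comp hns)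
  have hz2 : Tendsto (fun n => (z (ns n)).2) atTop (𝓝 a.2) :=
    (continuous_snd.tendsto a).comp (hz.comp hns)
  obtain ⟨φ, hφ, hae⟩ := exists_subseq_ae_tendsto hz2
  obtain ⟨C, hC⟩ := exists_bound_truncate hf hM hz1.isCompact_insert_range
  refine ⟨φ, tendsto_toLp_of_bounded hq (fun n => memLp_superposition hf hM _)
    (memLp_superposition hf hM a) (C := C) (fun n => Eventually.of_forall fun x =>
      hC _ (mem_insert_of_mem _ ⟨φ n, rfl⟩) _) ?_⟩
  filter_upwards [hae] with x hx
  refine (hf.tendsto _).comp (Tendsto.prodMk_nhds (hz1.comp hφ.tendsto_atTop) ?_)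
  exact ((continuous_truncate M).tendsto _).comp (tendsto_pi_nhds.2 hx)

end Superposition

/-! ### Functions with a weak derivative on an interval -/

section WeakDerivative

variable {E : Type*} [NormedAddCommGroup E] [NormedSpace ℝ E] {T : ℝ}

/-- `w'` is the weak derivative of `w` on `(0, T)`. -/
def HasWeakDeriv (T : ℝ) (w w' : ℝ → E) : Prop :=
  ∀ φ : ℝ → ℝ, ContDiff ℝ ∞ φ → HasCompactSupport φ → tsupport φ ⊆ Ioo 0 T →
    ∫ t in Ioo 0 T, deriv φ t • w t = -∫ t in Ioo 0 T, φ t • w' t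

theorem exists_primitive_testFunction (hT : 0 < T) {η : ℝ → ℝ} (h1 : ContDiff ℝ ∞ η)
    (h2 : HasCompactSupport η) (h3 : tsupport η ⊆ Ioo 0 T) (h4 : ∫ t, η t = 0) :
    ∃ Φ : ℝ → ℝ, ContDiff ℝ ∞ Φ ∧ HasCompactSupport Φ ∧ tsupport Φ ⊆ Ioo 0 T ∧
      (∀ t, HasDerivAt Φ (η t) t) := by
  have hη := h1.continuous
  -- Adjoining `T / 2` keeps the set nonempty when `η = 0`, so its infimum and supremum are points
  -- of `(0, T)`.
  let K := insert (T / 2) (tsupport η)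
  have hK : IsCompact K := h2.isCompact.insert _
  have hKne : K.Nonempty := ⟨_, mem_insert _ _⟩
  have hKT : K ⊆ Ioo 0 T := insert_subset ⟨by linarith, by linarith⟩ h3
  have ha := hKT (hK.sInf_mem hKne)
  have hb := hKT (hK.sSup_mem hKne)
  have hKI : K ⊆ Icc (sInf K) (sSup K) := fun t ht =>
    ⟨csInf_le hK.bddBelow ht, le_csSup hK.bddAbove ht⟩
  have hzero : ∀ t, t ∉ Icc (sInf K) (sSup K) → η t = 0 := fun t ht =>
    image_eq_zero_of_notMem_tsupport fun h => ht (hKI (mem_insert_of_mem _ h))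
  let Φ : ℝ → ℝ := fun t => ∫ s in (0 : ℝ)..t, η s
  have hd : ∀ t, HasDerivAt Φ (η t) t := fun t =>
    intervalIntegral.integral_hasDerivAt_right (hη.intervalIntegrable _ _)
      (hη.stronglyMeasurableAtFilter _ _) hη.continuousAt
  have hsupp : ∀ t, t ∉ Icc (sInf K) (sSup K) → Φ t = 0 := by
    intro t ht
    rcases lt_or_ge t (sInf K) with h | h
    · refine intervalIntegral.integral_zero_ae (Eventually.of_forall fun s hs => hzero s ?_)
      intro hs'
      have h5 : s ≤ max 0 t := hs.2
      have : max 0 t < sInf K := max_lt ha.1 h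
      linarith [hs'.1]
    · have ht' : sSup K < t := by
        by_contra hcon
        exact ht ⟨h, not_lt.1 hcon⟩
      have h0t : 0 ≤ t := (hb.1.trans ht').le
      change ∫ s in (0 : ℝ)..t, η s = 0
      rw [intervalIntegral.integral_of_le h0t]
      refine Eq.trans ?_ h4
      refine setIntegral_eq_integral_of_forall_compl_eq_zero fun s hs => hzero s fun hs' => hs ?_
      exact ⟨ha.1.trans_le hs'.1, hs'.2.trans ht'.le⟩
  have hts : tsupport Φ ⊆ Icc (sInf K) (sSup K) := by
    refine closure_minimal (fun t ht => ?_) isClosed_Icc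
    by_contra hcon
    exact ht (hsupp t hcon)
  refine ⟨Φ, ?_, ?_, hts.trans fun t ht => ⟨ha.1.trans_le ht.1, ht.2.trans_lt hb.2⟩, hd⟩
  · rw [contDiff_infty_iff_deriv]
    refine ⟨fun t => (hd t).differentiableAt, ?_⟩
    rwa [show deriv Φ = η from funext fun t => (hd t).deriv]
  · exact HasCompactSupport.of_support_subset_isCompact isCompact_Icc
      (subset_closure.trans hts)

variable [CompleteSpace E]

/-- Integration by parts through Fubini on the triangle `s < t`: integrating `η` over `(s, T)`
leaves `-Φ s`, since `Φ T = 0`. -/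
theorem integral_deriv_smul_primitive {Φ η : ℝ → ℝ} (hη : Continuous η)
    (hΦ : ∀ t, HasDerivAt Φ (η t) t) (hΦT : Φ T = 0) {w' : ℝ → E}
    (hw' : IntegrableOn w' (Ioo 0 T)) :
    ∫ t in Ioo 0 T, η t • (∫ s in (0 : ℝ)..t, w' s) = -∫ s in Ioo 0 T, Φ s • w' s := by
  set μ := volume.restrict (Ioo (0 : ℝ) T)
  have hηi : Integrable η μ := (hη.integrableOn_Icc).mono_set Ioo_subset_Icc_self
  have hset : MeasurableSet {z : ℝ × ℝ | z.2 < z.1} :=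
    measurableSet_lt measurable_snd measurable_fst
  have hint : Integrable (Function.uncurry fun t s => {z : ℝ × ℝ | z.2 < z.1}.indicator
      (fun z => η z.1 • w' z.2) (t, s)) (μ.prod μ) := (hηi.smul_prod hw').indicator hset
  have hswap := integral_integral_swap hint
  have hL : ∫ t in Ioo 0 T, η t • (∫ s in (0 : ℝ)..t, w' s) =
      ∫ t, ∫ s, {z : ℝ × ℝ | z.2 < z.1}.indicator (fun z => η z.1 • w' z.2) (t, s) ∂μ ∂μ := by
    refine setIntegral_congr_fun measurableSet_Ioo fun t ht => ?_
    have h1 : ∀ s, {z : ℝ × ℝ | z.2 < z.1}.indicator (fun z => η z.1 • w' z.2) (t, s) =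
        (Iio t).indicator (fun s => η t • w' s) s := fun s => rfl
    simp only [h1]
    rw [integral_indicator measurableSet_Iio, Measure.restrict_restrict measurableSet_Iio,
      integral_smul, intervalIntegral.integral_of_le ht.1.le, integral_Ioc_eq_integral_Ioo]
    congr 3
    ext s
    exact ⟨fun hs => ⟨hs.2, hs.1, hs.2.trans ht.2⟩, fun hs => ⟨hs.2.1, hs.1⟩⟩
  have hR : -∫ s in Ioo 0 T, Φ s • w' s =
      ∫ s, ∫ t, {z : ℝ × ℝ | z.2 < z.1}.indicator (fun z => η z.1 • w' z.2) (t, s) ∂μ ∂μ := by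
    rw [← integral_neg]
    refine setIntegral_congr_fun measurableSet_Ioo fun s hs => ?_
    have h1 : ∀ t, {z : ℝ × ℝ | z.2 < z.1}.indicator (fun z => η z.1 • w' z.2) (t, s) =
        (Ioi s).indicator (fun t => η t • w' s) t := fun t => rfl
    simp only [h1]
    rw [integral_indicator measurableSet_Ioi, Measure.restrict_restrict measurableSet_Ioi,
      integral_smul_const]
    have h2 : Ioi s ∩ Ioo 0 T = Ioo s T := by
      ext t
      exact ⟨fun ht => ⟨ht.1, ht.2.2⟩, fun ht => ⟨ht.1, hs.1.trans ht.1, ht.2⟩⟩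
    rw [h2, ← integral_Ioc_eq_integral_Ioo, ← intervalIntegral.integral_of_le hs.2.le,
      intervalIntegral.integral_eq_sub_of_hasDerivAt (fun t _ => hΦ t)
        (hη.intervalIntegrable _ _), hΦT, zero_sub, neg_smul]
  rw [hL, hR, hswap]

/-- A function with an integrable weak derivative is a primitive of it. -/
theorem HasWeakDeriv.exists_eq_primitive (hT : 0 < T) {w w' : ℝ → E} (h : HasWeakDeriv T w w')
    (hw : IntegrableOn w (Ioo 0 T)) (hw' : IntegrableOn w' (Ioo 0 T)) :
    ∃ c : E, ∀ᵐ t ∂volume.restrict (Ioo 0 T), w t = c + ∫ s in (0 : ℝ)..t, w' s := by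
  let F : ℝ → E := fun t => ∫ s in (0 : ℝ)..t, w' s
  have hw'I : IntervalIntegrable w' volume 0 T := by
    rw [intervalIntegrable_iff_integrableOn_Ioo_of_le hT.le]
    exact hw'
  have hFc : ContinuousOn F (Icc 0 T) := by
    have := intervalIntegral.continuousOn_primitive_interval' hw'I left_mem_uIcc
    rwa [uIcc_of_le hT.le] at this
  have hF : IntegrableOn F (Ioo 0 T) := (hFc.integrableOn_Icc).mono_set Ioo_subset_Icc_self
  let b : ContDiffBump (T / 2) := ⟨T / 8, T / 4, by linarith, by linarith⟩
  set ψ : ℝ → ℝ := b.normed volume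
  have hψ1 : ContDiff ℝ ∞ ψ := b.contDiff_normed
  have hψ2 : HasCompactSupport ψ := b.hasCompactSupport_normed
  have hψ3 : tsupport ψ ⊆ Ioo 0 T := by
    rw [b.tsupport_normed_eq, Real.closedBall_eq_Icc]
    intro t ht
    have hb : b.rOut = T / 4 := rfl
    rw [hb] at ht
    exact ⟨by linarith [ht.1], by linarith [ht.2]⟩
  have hψ4 : ∫ t, ψ t = 1 := b.integral_normed
  have hmul : ∀ {φ : ℝ → ℝ}, Continuous φ → HasCompactSupport φ → ∀ {f : ℝ → E},
      IntegrableOn f (Ioo 0 T) → Integrable (fun t => φ t • f t) (volume.restrict (Ioo 0 T)) := by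
    intro φ hφ hc f hf
    obtain ⟨C, hC⟩ := hc.exists_bound_of_continuous hφ
    exact hf.bdd_smul C hφ.aestronglyMeasurable (Eventually.of_forall hC)
  -- The constant is the average of `w - F` against a test function of mass one.
  let c : E := ∫ t in Ioo 0 T, ψ t • (w t - F t)
  refine ⟨c, ?_⟩
  have hloc : LocallyIntegrableOn (fun t => w t - (c + F t)) (Ioo 0 T) :=
    (hw.sub ((integrable_const c).add hF)).locallyIntegrableOn
  have key := isOpen_Ioo.ae_eq_zero_of_integral_contDiff_smul_eq_zero hloc ?_
  · rw [ae_restrict_iff' measurableSet_Ioo]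
    filter_upwards [key] with t ht htT
    exact sub_eq_zero.1 (ht htT)
  intro φ h1 h2 h3
  have hout : ∀ t, t ∉ Ioo 0 T → φ t = 0 := fun t ht =>
    image_eq_zero_of_notMem_tsupport fun h => ht (h3 h)
  rw [← setIntegral_eq_integral_of_forall_compl_eq_zero (s := Ioo 0 T)
    (fun t ht => by rw [hout t ht, zero_smul])]
  set a := ∫ t, φ t
  have ha : a = ∫ t in Ioo 0 T, φ t :=
    (setIntegral_eq_integral_of_forall_compl_eq_zero hout).symm
  -- Removing the mass of `φ` gives mean zero, so `η` is the derivative of a test function and is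
  -- orthogonal to `w - F` (du Bois-Reymond).
  let η : ℝ → ℝ := fun t => φ t - a * ψ t
  have hη1 : ContDiff ℝ ∞ η := h1.sub (contDiff_const.mul hψ1)
  have hη2 : HasCompactSupport η := h2.sub hψ2.mul_left
  have hη3 : tsupport η ⊆ Ioo 0 T :=
    (tsupport_sub _ _).trans (union_subset h3 ((tsupport_mul_subset_right).trans hψ3))
  have hη4 : ∫ t, η t = 0 := by
    rw [integral_sub (h1.continuous.integrable_of_hasCompactSupport h2)
      ((hψ1.continuous.integrable_of_hasCompactSupport hψ2).const_mul a), integral_const_mul, hψ4,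
      mul_one, sub_self]
  obtain ⟨Φ, hΦ1, hΦ2, hΦ3, hΦd⟩ := exists_primitive_testFunction hT hη1 hη2 hη3 hη4
  have hΦT : Φ T = 0 := image_eq_zero_of_notMem_tsupport fun h => (hΦ3 h).2.false
  have e1 := h Φ hΦ1 hΦ2 hΦ3
  rw [← integral_deriv_smul_primitive hη1.continuous hΦd hΦT hw',
    show deriv Φ = η from funext fun t => (hΦd t).deriv] at e1
  have hwF : IntegrableOn (fun t => w t - F t) (Ioo 0 T) := hw.sub hF
  have e2 : ∫ t in Ioo 0 T, η t • (w t - F t) = 0 := by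
    simp_rw [smul_sub]
    rw [integral_sub (hmul hη1.continuous hη2 hw) (hmul hη1.continuous hη2 hF), e1, sub_self]
  have e3 : ∫ t in Ioo 0 T, η t • (w t - F t) =
      (∫ t in Ioo 0 T, φ t • (w t - F t)) - a • c := by
    have hi : Integrable (fun t => a • ψ t • (w t - F t)) (volume.restrict (Ioo 0 T)) :=
      (hmul hψ1.continuous hψ2 hwF).smul a
    rw [← integral_smul, ← integral_sub (hmul h1.continuous h2 hwF) hi]
    refine integral_congr_ae (Eventually.of_forall fun t => ?_)
    simp only [η, sub_smul, mul_smul]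
  rw [e2] at e3
  have e4 : ∀ t, φ t • (w t - (c + F t)) = φ t • (w t - F t) - φ t • c := fun t => by
    rw [← smul_sub]
    congr 1
    abel
  simp_rw [e4]
  rw [integral_sub (hmul h1.continuous h2 hwF) (hmul h1.continuous h2 (integrable_const c)),
    integral_smul_const, ← ha]
  exact e3.symm

/-- Any two values on `[a, b]` differ by at most the integral of `‖w'‖`, hence each value differs
from the mean by no more than that. -/
theorem integral_norm_primitive_le {a b : ℝ} (hab : a ≤ b) (c : E) {w' : ℝ → E}
    (ha : IntervalIntegrable w' volume 0 a) (hw' : IntervalIntegrable w' volume a b) :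
    ∫ t in a..b, ‖c + ∫ s in (0 : ℝ)..t, w' s‖ ≤
      ‖∫ t in a..b, (c + ∫ s in (0 : ℝ)..t, w' s)‖ + (b - a) * ∫ t in a..b, ‖w' t‖ := by
  rcases hab.eq_or_lt with rfl | hlt
  · simp
  set W : ℝ → E := fun t => c + ∫ s in (0 : ℝ)..t, w' s
  set D := ∫ t in a..b, ‖w' t‖
  have hsub : ∀ t ∈ Icc a b, IntervalIntegrable w' volume 0 t := fun t ht =>
    ha.trans (hw'.mono_set (by
      rw [uIcc_of_le ht.1, uIcc_of_le hab]
      exact Icc_subset_Icc_right ht.2))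
  have hW : ContinuousOn W (Icc a b) := by
    have h1 := intervalIntegral.continuousOn_primitive_interval' hw' left_mem_uIcc
    rw [uIcc_of_le hab] at h1
    refine ((continuousOn_const (c := c + ∫ s in (0 : ℝ)..a, w' s)).add h1).congr fun t ht => ?_
    simp only [W, Pi.add_apply]
    rw [add_assoc, intervalIntegral.integral_add_adjacent_intervals ha
      (hw'.mono_set (by
        rw [uIcc_of_le ht.1, uIcc_of_le hab]
        exact Icc_subset_Icc_right ht.2))]
  have hWi : IntervalIntegrable W volume a b := by
    refine ContinuousOn.intervalIntegrable ?_
    rwa [uIcc_of_le hab]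
  have hdiff : ∀ t ∈ Icc a b, ∀ s ∈ Icc a b, ‖W t - W s‖ ≤ D := by
    intro t ht s hs
    have h1 : W t - W s = ∫ r in s..t, w' r := by
      simp only [W]
      rw [add_sub_add_left_eq_sub, intervalIntegral.integral_interval_sub_left (hsub t ht)
        (hsub s hs)]
    rw [h1]
    refine intervalIntegral.norm_integral_le_integral_norm_uIoc.trans ?_
    simp only [D]
    rw [intervalIntegral.integral_of_le hab]
    refine setIntegral_mono_set ?_ (Eventually.of_forall fun r => norm_nonneg _)
      (LE.le.eventuallyLE ?_)
    · exact ((intervalIntegrable_iff_integrableOn_Ioc_of_le hab).1 hw').norm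
    · exact Ioc_subset_Ioc (le_min hs.1 ht.1) (max_le hs.2 ht.2)
  have hpt : ∀ t ∈ Icc a b, ‖W t‖ ≤ (b - a)⁻¹ * ‖∫ t in a..b, W t‖ + D := by
    intro t ht
    have h1 : ‖∫ s in a..b, (W t - W s)‖ ≤ D * |b - a| :=
      intervalIntegral.norm_integral_le_of_norm_le_const fun s hs => by
        rw [uIoc_of_le hab] at hs
        exact hdiff t ht s ⟨hs.1.le, hs.2⟩
    rw [intervalIntegral.integral_sub intervalIntegrable_const hWi,
      intervalIntegral.integral_const, abs_of_pos (sub_pos.2 hlt)] at h1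
    have h2 : ‖(b - a) • W t‖ ≤ ‖∫ t in a..b, W t‖ + D * (b - a) := by
      have := norm_add_le (∫ t in a..b, W t) ((b - a) • W t - ∫ t in a..b, W t)
      rw [add_sub_cancel] at this
      linarith
    rw [norm_smul, Real.norm_of_nonneg (sub_pos.2 hlt).le] at h2
    have h3 : 0 < b - a := sub_pos.2 hlt
    rw [← mul_le_mul_iff_right₀ h3, mul_add, ← mul_assoc, mul_inv_cancel₀ h3.ne', one_mul]
    linarith
  calc ∫ t in a..b, ‖W t‖ ≤ ∫ _ in a..b, ((b - a)⁻¹ * ‖∫ t in a..b, W t‖ + D) :=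
        intervalIntegral.integral_mono_on hab hWi.norm intervalIntegrable_const hpt
    _ = _ := by
      rw [intervalIntegral.integral_const, smul_eq_mul, mul_add, ← mul_assoc,
        mul_inv_cancel₀ (sub_pos.2 hlt).ne', one_mul]

/-- The `L¹` norm of a function with a weak derivative is controlled by its integrals over a
partition and by the mesh times the `L¹` norm of the derivative. -/
theorem HasWeakDeriv.integral_norm_le (hT : 0 < T) {w w' : ℝ → E} (h : HasWeakDeriv T w w')
    (hw : IntegrableOn w (Ioo 0 T)) (hw' : IntegrableOn w' (Ioo 0 T)) {N : ℕ} (hN : 0 < N) :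
    ∫ t in Ioo 0 T, ‖w t‖ ≤
      ∑ k ∈ Finset.range N, ‖∫ t in Ioo 0 T,
        (Ioc (k * (T / N)) ((k + 1 : ℕ) * (T / N))).indicator (fun _ => (1 : ℝ)) t • w t‖ +
      T / N * ∫ t in Ioo 0 T, ‖w' t‖ := by
  obtain ⟨c, hc⟩ := h.exists_eq_primitive hT hw hw'
  set W : ℝ → E := fun t => c + ∫ s in (0 : ℝ)..t, w' s with hWdef
  have hN' : (0 : ℝ) < N := Nat.cast_pos.2 hN
  have hTN : 0 < T / N := by positivity
  let x : ℕ → ℝ := fun k => k * (T / N)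
  have hxmono : Monotone x := fun k l hkl =>
    mul_le_mul_of_nonneg_right (Nat.cast_le.2 hkl) hTN.le
  have hx0 : x 0 = 0 := by simp [x]
  have hxN : x N = T := by
    simp only [x]
    field_simp
  have hIoc : ∀ {F : Type _} [NormedAddCommGroup F] [NormedSpace ℝ F] (f : ℝ → F),
      ∫ t in Ioo 0 T, f t = ∫ t in (0 : ℝ)..T, f t := fun f => by
    rw [intervalIntegral.integral_of_le hT.le, integral_Ioc_eq_integral_Ioo]
  have hw'I : IntervalIntegrable w' volume 0 T := by
    rw [intervalIntegrable_iff_integrableOn_Ioo_of_le hT.le]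
    exact hw'
  have hw'k : ∀ k < N, IntervalIntegrable w' volume (x k) (x (k + 1)) := fun k hk =>
    hw'I.mono_set (by
      rw [uIcc_of_le (hxmono k.le_succ), uIcc_of_le hT.le]
      exact Icc_subset_Icc (hx0 ▸ hxmono k.zero_le) (hxN ▸ hxmono hk))
  have hw'0 : ∀ k < N, IntervalIntegrable w' volume 0 (x k) := fun k hk =>
    hw'I.mono_set (by
      rw [uIcc_of_le (hx0 ▸ hxmono k.zero_le : (0 : ℝ) ≤ x k), uIcc_of_le hT.le]
      exact Icc_subset_Icc le_rfl (hxN ▸ hxmono hk.le))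
  have hWc : ContinuousOn W (Icc 0 T) := by
    have := intervalIntegral.continuousOn_primitive_interval' hw'I left_mem_uIcc
    rw [uIcc_of_le hT.le] at this
    exact continuousOn_const.add this
  have hWk : ∀ k < N, IntervalIntegrable (fun t => ‖W t‖) volume (x k) (x (k + 1)) := by
    intro k hk
    refine ContinuousOn.intervalIntegrable (hWc.norm.mono ?_)
    rw [uIcc_of_le (hxmono k.le_succ)]
    exact Icc_subset_Icc (hx0 ▸ hxmono k.zero_le) (hxN ▸ hxmono hk)
  have hpart : ∀ k < N, ∫ t in Ioo 0 T,
      (Ioc (k * (T / N)) ((k + 1 : ℕ) * (T / N))).indicator (fun _ => (1 : ℝ)) t • w t =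
      ∫ t in x k..x (k + 1), W t := by
    intro k hk
    rw [intervalIntegral.integral_of_le (hxmono k.le_succ)]
    have h1 : ∀ᵐ t ∂volume.restrict (Ioo 0 T),
        (Ioc (k * (T / N)) ((k + 1 : ℕ) * (T / N))).indicator (fun _ => (1 : ℝ)) t • w t =
        (Ioc (x k) (x (k + 1))).indicator W t := by
      filter_upwards [hc] with t ht
      by_cases hmem : t ∈ Ioc (x k) (x (k + 1))
      · rw [indicator_of_mem hmem, indicator_of_mem hmem, one_smul, ht]
      · rw [indicator_of_notMem hmem, indicator_of_notMem hmem, zero_smul]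
    rw [integral_congr_ae h1, ← integral_Ioc_eq_integral_Ioo, setIntegral_indicator
      measurableSet_Ioc]
    congr 2
    exact inter_eq_right.2 (Ioc_subset_Ioc (hx0 ▸ hxmono k.zero_le) (hxN ▸ hxmono hk))
  calc ∫ t in Ioo 0 T, ‖w t‖ = ∫ t in Ioo 0 T, ‖W t‖ :=
        integral_congr_ae (hc.mono fun t ht => congrArg norm ht)
    _ = ∫ t in x 0..x N, ‖W t‖ := by rw [hIoc, hx0, hxN]
    _ = ∑ k ∈ Finset.range N, ∫ t in x k..x (k + 1), ‖W t‖ :=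
        (intervalIntegral.sum_integral_adjacent_intervals hWk).symm
    _ ≤ ∑ k ∈ Finset.range N, (‖∫ t in x k..x (k + 1), W t‖ +
          T / N * ∫ t in x k..x (k + 1), ‖w' t‖) := by
        refine Finset.sum_le_sum fun k hk => ?_
        have hk' := Finset.mem_range.1 hk
        refine (integral_norm_primitive_le (hxmono k.le_succ) c (hw'0 k hk')
          (hw'k k hk')).trans_eq ?_
        have : x (k + 1) - x k = T / N := by
          simp only [x]
          push_cast
          ring
        rw [this]
    _ = _ := by
        rw [Finset.sum_add_distrib, ← Finset.mul_sum,
          intervalIntegral.sum_integral_adjacent_intervals (fun k hk => (hw'k k hk).norm), hx0,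
          hxN, hIoc]
        congr 1
        refine Finset.sum_congr rfl fun k hk => ?_
        rw [hpart k (Finset.mem_range.1 hk)]

end WeakDerivative

/-! ### Compactness in time and space -/

section AubinLions

variable {V V' W X : Type*} [NormedAddCommGroup V] [NormedSpace ℝ V]
  [NormedAddCommGroup V'] [NormedSpace ℝ V'] [NormedAddCommGroup W] [NormedSpace ℝ W]
  [NormedAddCommGroup X] [NormedSpace ℝ X] {ι : V →L[ℝ] V'} {p : ℝ≥0∞} [Fact (1 ≤ p)] {T : ℝ}

theorem WeaklyTendsto.coe_submodule {S : Submodule ℝ V} {u : ℕ → S} {a : S}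
    (h : WeaklyTendsto u a) : WeaklyTendsto (fun n => (u n : V)) a :=
  h.map S.subtypeL

theorem WeaklyTendsto.withLp_fst {u : ℕ → WithLp 1 (V × W)} {a : WithLp 1 (V × W)}
    (h : WeaklyTendsto u a) : WeaklyTendsto (fun n => (u n).fst) a.fst :=
  h.map (WithLp.fstL 1 ℝ V W)

theorem WeaklyTendsto.withLp_snd {u : ℕ → WithLp 1 (V × W)} {a : WithLp 1 (V × W)}
    (h : WeaklyTendsto u a) : WeaklyTendsto (fun n => (u n).snd) a.snd :=
  h.map (WithLp.sndL 1 ℝ V W)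

theorem WeaklyTendsto.state {u : ℕ → StateSpace ι p T} {a : StateSpace ι p T}
    (h : WeaklyTendsto u a) :
    WeaklyTendsto (fun n => StateSpace.state (u n)) (StateSpace.state a) :=
  h.coe_submodule.withLp_fst

theorem WeaklyTendsto.timeDeriv {u : ℕ → StateSpace ι p T} {a : StateSpace ι p T}
    (h : WeaklyTendsto u a) :
    WeaklyTendsto (fun n => StateSpace.timeDeriv (u n)) (StateSpace.timeDeriv a) :=
  h.coe_submodule.withLp_snd.coe_submodule.withLp_snd

theorem integrable_Lp {α E : Type*} [MeasurableSpace α] {μ : Measure α} [IsFiniteMeasure μ]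
    [NormedAddCommGroup E] (v : Lp E p μ) : Integrable v μ :=
  (Lp.memLp v).integrable Fact.out

theorem exists_eLpNorm_le {α : Type*} [MeasurableSpace α] (μ : Measure α) [IsFiniteMeasure μ]
    (E : Type*) [NormedAddCommGroup E] {s' s : ℝ≥0∞} (h1 : 1 ≤ s') (hs : s' ≤ s) :
    ∃ c : ℝ≥0∞, c ≠ ⊤ ∧ ∀ f : α → E, AEStronglyMeasurable f μ →
      eLpNorm f s' μ ≤ c * eLpNorm f s μ := by
  have hexp : 0 ≤ 1 / s'.toReal - 1 / s.toReal := by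
    rcases eq_or_ne s ⊤ with rfl | hst
    · simp
    · exact sub_nonneg.2 (one_div_le_one_div_of_le
        (ENNReal.toReal_pos (zero_lt_one.trans_le h1).ne'
          (hs.trans_lt (lt_top_iff_ne_top.2 hst)).ne)
        (ENNReal.toReal_mono hst hs))
  refine ⟨_, ENNReal.rpow_ne_top_of_nonneg hexp (measure_ne_top μ univ), fun f hf => ?_⟩
  rw [mul_comm]
  exact eLpNorm_le_eLpNorm_mul_rpow_measure_univ hs hf

theorem exists_integral_norm_le {α E : Type*} [MeasurableSpace α] {μ : Measure α}
    [IsFiniteMeasure μ] [NormedAddCommGroup E] :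
    ∃ C : ℝ, 0 ≤ C ∧ ∀ v : Lp E p μ, ∫ t, ‖v t‖ ∂μ ≤ C * ‖v‖ := by
  obtain ⟨c, hc, h⟩ := exists_eLpNorm_le μ E le_rfl (Fact.out : 1 ≤ p)
  refine ⟨c.toReal, ENNReal.toReal_nonneg, fun v => ?_⟩
  have h1 : ∫ t, ‖v t‖ ∂μ = (eLpNorm v 1 μ).toReal := by
    rw [eLpNorm_one_eq_lintegral_enorm, integral_norm_eq_lintegral_enorm
      (Lp.aestronglyMeasurable v)]
  rw [h1, Lp.norm_def, ← ENNReal.toReal_mul]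
  exact ENNReal.toReal_mono (ENNReal.mul_ne_top hc (Lp.eLpNorm_ne_top v))
    (h v (Lp.aestronglyMeasurable v))

variable [CompleteSpace V] [CompleteSpace V'] [CompleteSpace W]

theorem StateSpace.hasWeakDeriv (j : V' →L[ℝ] W) (u : StateSpace ι p T) :
    HasWeakDeriv T (fun t => j (ι (StateSpace.state u t)))
      (fun t => j (StateSpace.timeDeriv u t)) := by
  intro φ h1 h2 h3
  have h := u.1.snd.2 φ h1 h2 h3
  have hu : u.1.snd.1.fst = ι.compLpL p (volume.restrict (Ioo 0 T)) u.1.fst := u.2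
  have hae : ∀ᵐ t ∂volume.restrict (Ioo 0 T), u.1.snd.1.fst t = ι (StateSpace.state u t) := by
    rw [hu]
    exact ι.coeFn_compLpL u.1.fst
  have i1 : Integrable (fun t => deriv φ t • u.1.snd.1.fst t) (volume.restrict (Ioo 0 T)) :=
    integrable_smul_Lp (h1.continuous_deriv (by simp)) h2.deriv _
  have i2 : Integrable (fun t => φ t • u.1.snd.1.snd t) (volume.restrict (Ioo 0 T)) :=
    integrable_smul_Lp h1.continuous h2 _
  have h' := congrArg j h
  rw [map_neg, ← j.integral_comp_comm i1, ← j.integral_comp_comm i2] at h'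
  simp only [map_smul] at h'
  refine Eq.trans (integral_congr_ae ?_) h'
  filter_upwards [hae] with t ht
  rw [ht]

/-- The Aubin–Lions lemma for a weakly null sequence of functions with bounded time derivatives. -/
theorem tendsto_integral_norm_of_weaklyTendsto (hT : 0 < T) (hV : WeaklySeqCompact V)
    {ι : V →L[ℝ] V'} {j : V' →L[ℝ] W} (hι : Function.Injective ι) (hj : Function.Injective j)
    {e : V →L[ℝ] X}
    (he : IsCompactOperator e) {c : ℝ} (hc : ∀ v, ‖j (ι v)‖ ≤ c * ‖e v‖)
    {v : ℕ → Lp V p (volume.restrict (Ioo 0 T))} {w : ℕ → Lp V' p (volume.restrict (Ioo 0 T))}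
    (hvw : ∀ n, HasWeakDeriv T (fun t => j (ι (v n t))) (fun t => j (w n t)))
    (hv : WeaklyTendsto v 0) {B' : ℝ} (hw : ∀ n, ‖w n‖ ≤ B') :
    Tendsto (fun n => ∫ t in Ioo 0 T, ‖e (v n t)‖) atTop (𝓝 0) := by
  obtain ⟨c₁, hc₁, hL₁⟩ := exists_integral_norm_le (p := p)
    (μ := volume.restrict (Ioo 0 T)) (E := V)
  obtain ⟨c₂, hc₂, hL₂⟩ := exists_integral_norm_le (p := p)
    (μ := volume.restrict (Ioo 0 T)) (E := V')
  obtain ⟨B, hB⟩ := hv.bounded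
  have hB0 : 0 ≤ B := (norm_nonneg _).trans (hB 0)
  have hB0' : 0 ≤ B' := (norm_nonneg _).trans (hw 0)
  set D₁ := c₁ * B
  have hD₁ : ∀ n, ∫ t, ‖v n t‖ ∂volume.restrict (Ioo 0 T) ≤ D₁ := fun n =>
    (hL₁ _).trans (mul_le_mul_of_nonneg_left (hB n) hc₁)
  set D₂ := ‖j‖ * (c₂ * B')
  have hD₂ : ∀ n, ∫ t, ‖j (w n t)‖ ∂volume.restrict (Ioo 0 T) ≤ D₂ := fun n => by
    have hi := integrable_Lp (w n)
    calc ∫ t, ‖j (w n t)‖ ∂volume.restrict (Ioo 0 T)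
        ≤ ∫ t, ‖j‖ * ‖w n t‖ ∂volume.restrict (Ioo 0 T) :=
          integral_mono (j.integrable_comp hi).norm (hi.norm.const_mul _) fun t => j.le_opNorm _
      _ = ‖j‖ * ∫ t, ‖w n t‖ ∂volume.restrict (Ioo 0 T) := integral_const_mul _ _
      _ ≤ D₂ := mul_le_mul_of_nonneg_left ((hL₂ _).trans (mul_le_mul_of_nonneg_left (hw n) hc₂))
          (norm_nonneg _)
  have hD₁0 : 0 ≤ D₁ := by positivity
  have hD₂0 : 0 ≤ D₂ := by positivity
  have hjint : ∀ n, Integrable (fun t => j (ι (v n t))) (volume.restrict (Ioo 0 T)) := fun n =>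
    j.integrable_comp (ι.integrable_comp (integrable_Lp _))
  have hW : Tendsto (fun n => ∫ t, ‖j (ι (v n t))‖ ∂volume.restrict (Ioo 0 T)) atTop (𝓝 0) := by
    -- Integration over `I` is bounded into `V`, so these integrals are weakly null there.
    -- Compactness of `e` makes their images strongly null, and `hc` transfers this to `W`.
    have hpart : ∀ I : Set ℝ, MeasurableSet I → Tendsto (fun n => ‖∫ t,
        I.indicator (fun _ => (1 : ℝ)) t • j (ι (v n t)) ∂volume.restrict (Ioo 0 T)‖)
          atTop (𝓝 0) := by
      intro I hI
      have hIm : Measurable (I.indicator fun _ => (1 : ℝ)) := measurable_const.indicator hI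
      have hIb : ∀ t, |I.indicator (fun _ => (1 : ℝ)) t| ≤ 1 := fun t => by
        by_cases ht : t ∈ I <;> simp [ht]
      obtain ⟨I', hI'⟩ := exists_integral_smul_clm (E := V) (p := p)
        (μ := volume.restrict (Ioo 0 T))
        hIm.aestronglyMeasurable hIb
      have h1 : ∀ n, ∫ t, I.indicator (fun _ => (1 : ℝ)) t • j (ι (v n t))
          ∂volume.restrict (Ioo 0 T) =
          j (ι (I' (v n))) := fun n => by
        have hi : Integrable (fun t => I.indicator (fun _ => (1 : ℝ)) t •
            v n t) (volume.restrict (Ioo 0 T)) :=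
          (integrable_Lp (v n)).bdd_smul 1 hIm.aestronglyMeasurable
            (Eventually.of_forall hIb)
        rw [hI']
        refine Eq.trans ?_ ((j.comp ι).integral_comp_comm hi)
        simp only [ContinuousLinearMap.comp_apply, map_smul]
      have h2 := hv.map I'
      rw [map_zero] at h2
      have h3 := (he.tendsto_of_weaklyTendsto h2).norm.const_mul c
      rw [norm_zero, mul_zero] at h3
      refine squeeze_zero (fun n => norm_nonneg _) (fun n => ?_) h3
      rw [h1]
      exact hc _
    refine tendsto_order.2 ⟨fun a ha => Eventually.of_forall fun n =>
      ha.trans_le (integral_nonneg fun t => norm_nonneg _), fun a ha => ?_⟩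
    -- The mesh `T / N` times the derivative bound `D₂` is then below `a / 2`.
    obtain ⟨N, hN⟩ := exists_nat_gt (T * D₂ / (a / 2))
    have hN0 : (0 : ℝ) < N := lt_of_le_of_lt (by positivity) hN
    have h1 := tendsto_finsetSum (Finset.range N) fun k _ => hpart
      (Ioc (k * (T / N)) ((k + 1 : ℕ) * (T / N))) measurableSet_Ioc
    rw [Finset.sum_const_zero] at h1
    filter_upwards [h1.eventually_lt_const (half_pos ha)] with n hn
    have h2 := (hvw n).integral_norm_le hT (hjint n)
      (j.integrable_comp (integrable_Lp (w n))) (Nat.cast_pos.1 hN0)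
    have h3 : T / N * ∫ t, ‖j (w n t)‖ ∂volume.restrict (Ioo 0 T) < a / 2 := by
      refine (mul_le_mul_of_nonneg_left (hD₂ n) (by positivity)).trans_lt ?_
      rw [div_lt_iff₀ (half_pos ha)] at hN
      rw [div_mul_eq_mul_div, div_lt_iff₀ hN0]
      linarith
    exact h2.trans_lt (by linarith)
  refine tendsto_order.2 ⟨fun a ha => Eventually.of_forall fun n =>
    ha.trans_le (integral_nonneg fun t => norm_nonneg _), fun a ha => ?_⟩
  -- With this `η` the `V` part contributes at most `a / 2`; the added `1` guards against `D₁ = 0`.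
  obtain ⟨C, hC, hE⟩ := ehrling hV he (S := j.comp ι) (hj.comp hι)
    (show 0 < a / 2 / (D₁ + 1) by positivity)
  have h1 := hW.const_mul C
  rw [mul_zero] at h1
  filter_upwards [h1.eventually_lt_const (half_pos ha)] with n hn
  have hi := integrable_Lp (v n)
  calc ∫ t, ‖e (v n t)‖ ∂volume.restrict (Ioo 0 T)
      ≤ ∫ t, (a / 2 / (D₁ + 1) * ‖v n t‖ +
          C * ‖j (ι (v n t))‖) ∂volume.restrict (Ioo 0 T) :=
        integral_mono (e.integrable_comp hi).norm
          ((hi.norm.const_mul _).add ((hjint n).norm.const_mul _)) fun t => hE _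
    _ = a / 2 / (D₁ + 1) * (∫ t, ‖v n t‖ ∂volume.restrict (Ioo 0 T)) +
          C * ∫ t, ‖j (ι (v n t))‖ ∂volume.restrict (Ioo 0 T) := by
        rw [integral_add (hi.norm.const_mul _) ((hjint n).norm.const_mul _), integral_const_mul,
          integral_const_mul]
    _ < a := by
        have h2 : a / 2 / (D₁ + 1) * (∫ t, ‖v n t‖ ∂volume.restrict (Ioo 0 T)) ≤ a / 2 := by
          rw [div_mul_eq_mul_div, div_le_iff₀ (by positivity)]
          exact mul_le_mul_of_nonneg_left ((hD₁ n).trans (by linarith)) (half_pos ha).le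
        linarith

/-- Weak convergence implies, for a subsequence, strong convergence of the images under a compact
operator at almost every time. -/
theorem exists_subseq_ae_tendsto_of_weaklyTendsto (hT : 0 < T) (hV : WeaklySeqCompact V)
    {ι : V →L[ℝ] V'} {j : V' →L[ℝ] W} (hι : Function.Injective ι) (hj : Function.Injective j)
    {e : V →L[ℝ] X} (he : IsCompactOperator e) {c : ℝ} (hc : ∀ v, ‖j (ι v)‖ ≤ c * ‖e v‖)
    {v : ℕ → Lp V p (volume.restrict (Ioo 0 T))} {w : ℕ → Lp V' p (volume.restrict (Ioo 0 T))}
    {a : Lp V p (volume.restrict (Ioo 0 T))} {b : Lp V' p (volume.restrict (Ioo 0 T))}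
    (hvw : ∀ n, HasWeakDeriv T (fun t => j (ι ((v n - a) t))) (fun t => j ((w n - b) t)))
    (hv : WeaklyTendsto v a) (hw : WeaklyTendsto w b) :
    ∃ φ : ℕ → ℕ, StrictMono φ ∧ ∀ᵐ t ∂volume.restrict (Ioo 0 T),
      Tendsto (fun n => e (v (φ n) t)) atTop (𝓝 (e (a t))) := by
  have h0 := hv.sub (weaklyTendsto_of_tendsto (tendsto_const_nhds (x := a)))
  rw [sub_self] at h0
  obtain ⟨B, hB⟩ := (hw.sub (weaklyTendsto_of_tendsto (tendsto_const_nhds (x := b)))).bounded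
  have h1 := tendsto_integral_norm_of_weaklyTendsto hT hV hι hj he hc hvw h0 hB
  have hint : ∀ v : Lp V p (volume.restrict (Ioo 0 T)),
      Integrable (fun t => e (v t)) (volume.restrict (Ioo 0 T)) := fun v =>
    e.integrable_comp (integrable_Lp _)
  have h2 : Tendsto (fun n => eLpNorm ((fun t => e (v n t)) - fun t => e (a t)) 1
      (volume.restrict (Ioo 0 T))) atTop (𝓝 0) := by
    have h3 := ENNReal.tendsto_ofReal h1
    rw [ENNReal.ofReal_zero] at h3
    refine h3.congr fun n => ?_
    rw [ofReal_integral_norm_eq_lintegral_enorm (hint _), eLpNorm_one_eq_lintegral_enorm]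
    refine lintegral_congr_ae ?_
    filter_upwards [Lp.coeFn_sub (v n) a] with t ht
    rw [ht, Pi.sub_apply, map_sub]
    rfl
  exact (tendstoInMeasure_of_tendsto_eLpNorm one_ne_zero (fun n => (hint _).1) (hint _).1
    h2).exists_seq_tendsto_ae

end AubinLions

/-- Boundedness of `Ω` embeds `L^s` into `L^s'`, so compatibility alone bounds the `W` norm by the
Sobolev norm. This is the comparison required in the Aubin–Lions step. -/
theorem exists_norm_le_of_sameIn {d κ : ℕ} {Ω : Set (EuclideanSpace ℝ (Fin d))}
    (hΩb : Bornology.IsBounded Ω) {s s' : ℝ≥0∞} [Fact (1 ≤ s)] [Fact (1 ≤ s')] (hs : s' ≤ s)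
    {V' W : Type*} [NormedAddCommGroup V'] [NormedSpace ℝ V'] [NormedAddCommGroup W]
    [NormedSpace ℝ W] (i : Lp ℝ s' (volume.restrict Ω) →L[ℝ] W) (j : V' →L[ℝ] W) :
    ∃ c : ℝ, ∀ (v : SobolevSpace Ω κ s) (w : V'), SameIn i j v w → ‖j w‖ ≤ c * ‖v‖ := by
  have : IsFiniteMeasure (volume.restrict Ω) := isFiniteMeasure_restrict.2 hΩb.measure_lt_top.ne
  obtain ⟨c, hc, h⟩ := exists_eLpNorm_le (volume.restrict Ω) ℝ (Fact.out : 1 ≤ s') hs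
  refine ⟨‖i‖ * c.toReal, fun v w hvw => ?_⟩
  obtain ⟨g, hg, hgw⟩ := hvw
  rw [← hgw, mul_assoc]
  refine (i.le_opNorm g).trans (mul_le_mul_of_nonneg_left ?_ (norm_nonneg _))
  have h1 : ‖g‖ ≤ c.toReal * ‖v.1 (MultiIdx.zero d κ)‖ := by
    rw [Lp.norm_def, Lp.norm_def, eLpNorm_congr_ae hg, ← ENNReal.toReal_mul]
    exact ENNReal.toReal_mono (ENNReal.mul_ne_top hc (Lp.eLpNorm_ne_top _))
      (h _ (Lp.aestronglyMeasurable _))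
  exact h1.trans (mul_le_mul_of_nonneg_left (PiLp.norm_apply_le v.1 _) ENNReal.toReal_nonneg)

theorem WeaklyTendsto.timeDerivIn {V V' W : Type*} [NormedAddCommGroup V] [NormedSpace ℝ V]
    [NormedAddCommGroup V'] [NormedSpace ℝ V'] [NormedAddCommGroup W] [NormedSpace ℝ W]
    {ι : V →L[ℝ] V'} {p q : ℝ≥0∞} [Fact (1 ≤ p)] [Fact (1 ≤ q)] {T : ℝ} (j : V' →L[ℝ] W)
    (hqp : q ≤ p) {u : ℕ → StateSpace ι p T} {a : StateSpace ι p T} (hu : WeaklyTendsto u a) :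
    WeaklyTendsto (fun n => StateSpace.timeDerivIn j hqp (u n))
      (StateSpace.timeDerivIn j hqp a) := by
  obtain ⟨c, hc, h⟩ := exists_eLpNorm_le (volume.restrict (Ioo 0 T)) W (Fact.out : 1 ≤ q) hqp
  let I : Lp W p (volume.restrict (Ioo 0 T)) →ₗ[ℝ] Lp W q (volume.restrict (Ioo 0 T)) :=
    { toFun := AddSubgroup.inclusion (Lp.antitone hqp)
      map_add' := fun _ _ => rfl
      map_smul' := fun _ _ => rfl }
  refine (hu.timeDeriv.map (j.compLpL p (volume.restrict (Ioo 0 T)))).map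
    (I.mkContinuous c.toReal fun v => ?_)
  rw [Lp.norm_def, Lp.norm_def, ← ENNReal.toReal_mul]
  exact ENNReal.toReal_mono (ENNReal.mul_ne_top hc (Lp.eLpNorm_ne_top v))
    (h v (Lp.aestronglyMeasurable v))

/-! ### The direct method -/

theorem le_of_tendsto_of_lowerSemicontinuous {Q : Type*} [TopologicalSpace Q] {R : Q → ℝ≥0∞}
    (hR : LowerSemicontinuous R) {θ : ℕ → Q} {a : Q} (hθ : Tendsto θ atTop (𝓝 a)) {ρ : ℝ≥0∞}
    (hρ : Tendsto (fun n => R (θ n)) atTop (𝓝 ρ)) : R a ≤ ρ :=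
  le_of_forall_lt fun y hy => by
    obtain ⟨z, hyz, hz⟩ := exists_between hy
    exact hyz.trans_le (ge_of_tendsto hρ ((hθ.eventually (hR a z hz)).mono fun n hn => hn.le))

theorem le_rpow_inv_of_mul_rpow_le {c x a B : ℝ} (hc : 0 < c) (hx : 0 ≤ x) (ha : 0 < a)
    (h : c * x ^ a ≤ B) : x ≤ (B / c) ^ a⁻¹ := by
  have h1 : x ^ a ≤ B / c := by
    rw [le_div_iff₀ hc]
    linarith
  calc x = (x ^ a) ^ a⁻¹ := by rw [← Real.rpow_mul hx, mul_inv_cancel₀ ha.ne', Real.rpow_one]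
    _ ≤ _ := Real.rpow_le_rpow (Real.rpow_nonneg hx _) h1 (inv_nonneg.2 ha.le)

/-- The direct method in abstract form. The residual `A` need only be weakly sequentially continuous
up to a subsequence, since one good subsequence of a minimizing sequence suffices. -/
theorem exists_minimizer {U Q F G : Type*} [NormedAddCommGroup U] [NormedSpace ℝ U]
    [PseudoMetricSpace Q] [ProperSpace Q] [NormedAddCommGroup F] [NormedSpace ℝ F]
    [NormedAddCommGroup G] [NormedSpace ℝ G] (hU : WeaklySeqCompact U) {R : Q → ℝ≥0∞}
    (hproper : ∃ θ, R θ ≠ ⊤) (hcoer : Tendsto R (Bornology.cobounded Q) (𝓝 ⊤))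
    (hlsc : LowerSemicontinuous R) {A : U → Q → F}
    (hA : ∀ (u : ℕ → U) (a : U) (θ : ℕ → Q) (η : Q), WeaklyTendsto u a → Tendsto θ atTop (𝓝 η) →
      ∃ φ : ℕ → ℕ, StrictMono φ ∧ WeaklyTendsto (fun n => A (u (φ n)) (θ (φ n))) (A a η))
    {K : U → G} (hK : WeakWeakContinuous K) {lam mu α β γ : ℝ} (hlam : 0 < lam) (hmu : 0 < mu)
    (hα : 0 < α) (hβ : 0 < β) (hγ : 0 < γ) :
    ∃ u θ, ENNReal.ofReal (lam * ‖A u θ‖ ^ α + mu * ‖K u‖ ^ β + ‖u‖ ^ γ) + R θ < ⊤ ∧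
      ∀ v η, ENNReal.ofReal (lam * ‖A u θ‖ ^ α + mu * ‖K u‖ ^ β + ‖u‖ ^ γ) + R θ ≤
        ENNReal.ofReal (lam * ‖A v η‖ ^ α + mu * ‖K v‖ ^ β + ‖v‖ ^ γ) + R η := by
  let J : U × Q → ℝ≥0∞ := fun z =>
    ENNReal.ofReal (lam * ‖A z.1 z.2‖ ^ α + mu * ‖K z.1‖ ^ β + ‖z.1‖ ^ γ) + R z.2
  obtain ⟨θ₀, hθ₀⟩ := hproper
  set m := sInf (range J)
  have hm : ∀ z, m ≤ J z := fun z => sInf_le ⟨z, rfl⟩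
  have hmtop : m < ⊤ := (hm (0, θ₀)).trans_lt
    (ENNReal.add_lt_top.2 ⟨ENNReal.ofReal_lt_top, lt_top_iff_ne_top.2 hθ₀⟩)
  obtain ⟨x, -, hx, hxJ⟩ := exists_seq_tendsto_sInf (⟨_, (0, θ₀), rfl⟩ : (range J).Nonempty)
    (OrderBot.bddBelow (range J))
  choose z' hz' using hxJ
  -- Dropping finitely many terms puts the whole sequence in the sublevel set at `m + 1`, which
  -- bounds every term of the functional.
  obtain ⟨N, hN⟩ := eventually_atTop.1 (hx.eventually_lt_const
    (show m < m + 1 from ENNReal.lt_add_right hmtop.ne one_ne_zero))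
  let z : ℕ → U × Q := fun n => z' (n + N)
  have hzm : Tendsto (fun n => J (z n)) atTop (𝓝 m) := by
    simp only [z, hz']
    exact (tendsto_add_atTop_iff_nat N).2 hx
  have hm1 : m + 1 ≠ ⊤ := ENNReal.add_ne_top.2 ⟨hmtop.ne, ENNReal.one_ne_top⟩
  have hzlt : ∀ n, J (z n) ≤ m + 1 := fun n => by
    simp only [z, hz']
    exact (hN _ (Nat.le_add_left _ _)).le
  set B := (m + 1).toReal
  have hreal : ∀ n, lam * ‖A (z n).1 (z n).2‖ ^ α + mu * ‖K (z n).1‖ ^ β + ‖(z n).1‖ ^ γ ≤ B :=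
    fun n => (ENNReal.ofReal_le_iff_le_toReal hm1).1 (le_self_add.trans (hzlt n))
  have hp1 : ∀ n, 0 ≤ lam * ‖A (z n).1 (z n).2‖ ^ α := fun n => by positivity
  have hp2 : ∀ n, 0 ≤ mu * ‖K (z n).1‖ ^ β := fun n => by positivity
  have hp3 : ∀ n, 0 ≤ ‖(z n).1‖ ^ γ := fun n => by positivity
  have hb1 : ∀ n, ‖A (z n).1 (z n).2‖ ≤ (B / lam) ^ α⁻¹ := fun n =>
    le_rpow_inv_of_mul_rpow_le hlam (norm_nonneg _) hα (by linarith [hreal n, hp2 n, hp3 n])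
  have hb2 : ∀ n, ‖K (z n).1‖ ≤ (B / mu) ^ β⁻¹ := fun n =>
    le_rpow_inv_of_mul_rpow_le hmu (norm_nonneg _) hβ (by linarith [hreal n, hp1 n, hp3 n])
  have hb3 : ∀ n, ‖(z n).1‖ ≤ (B / 1) ^ γ⁻¹ := fun n =>
    le_rpow_inv_of_mul_rpow_le one_pos (norm_nonneg _) hγ (by linarith [hreal n, hp1 n, hp2 n])
  have hbdd : Bornology.IsBounded {θ | R θ ≤ m + 1} := by
    rw [← Bornology.isCobounded_compl_iff]
    filter_upwards [hcoer.eventually_const_lt (lt_top_iff_ne_top.2 hm1)] with θ hθ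
    exact fun h => (not_lt.2 h) hθ
  obtain ⟨θ, -, φ₁, hφ₁, hθ⟩ := tendsto_subseq_of_bounded hbdd
    (x := fun n => (z n).2) fun n => le_add_self.trans (hzlt n)
  obtain ⟨u, φ₂, hφ₂, hu⟩ := hU (fun n => (z (φ₁ n)).1) ⟨_, fun n => hb3 _⟩
  obtain ⟨φ₃, hφ₃, hAw⟩ := hA _ u _ θ hu (hθ.comp hφ₂.tendsto_atTop)
  set ψ : ℕ → ℕ := fun n => φ₁ (φ₂ (φ₃ n))
  -- Along a subsequence the three norms converge, and so do the values of `R` in the compact space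
  -- `[0, ∞]`. The infimum is then computed exactly and compared with the value at the limit.
  obtain ⟨⟨a, b, c⟩, -, φ₄, hφ₄, habc⟩ := tendsto_subseq_of_bounded
    ((Metric.isBounded_Icc (0 : ℝ) ((B / lam) ^ α⁻¹)).prod
      ((Metric.isBounded_Icc (0 : ℝ) ((B / mu) ^ β⁻¹)).prod
        (Metric.isBounded_Icc (0 : ℝ) ((B / 1) ^ γ⁻¹))))
    (x := fun n => (‖A (z (ψ n)).1 (z (ψ n)).2‖, ‖K (z (ψ n)).1‖, ‖(z (ψ n)).1‖))
    fun n => ⟨⟨norm_nonneg _, hb1 _⟩, ⟨norm_nonneg _, hb2 _⟩, ⟨norm_nonneg _, hb3 _⟩⟩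
  obtain ⟨ρ, φ₅, hφ₅, hρ⟩ := CompactSpace.tendsto_subseq fun n => R (z (ψ (φ₄ n))).2
  have habc' := habc.comp hφ₅.tendsto_atTop
  have h45 : StrictMono fun n => φ₄ (φ₅ n) := hφ₄.comp hφ₅
  have hta : Tendsto (fun n => ‖A (z (ψ (φ₄ (φ₅ n)))).1 (z (ψ (φ₄ (φ₅ n)))).2‖) atTop (𝓝 a) :=
    (continuous_fst.tendsto _).comp habc'
  have htb : Tendsto (fun n => ‖K (z (ψ (φ₄ (φ₅ n)))).1‖) atTop (𝓝 b) :=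
    ((continuous_fst.comp continuous_snd).tendsto _).comp habc'
  have htc : Tendsto (fun n => ‖(z (ψ (φ₄ (φ₅ n)))).1‖) atTop (𝓝 c) :=
    ((continuous_snd.comp continuous_snd).tendsto _).comp habc'
  have hψ : StrictMono fun n => ψ (φ₄ (φ₅ n)) := (hφ₁.comp (hφ₂.comp hφ₃)).comp h45
  have hu' := hu.comp (hφ₃.comp h45)
  have hla : ‖A u θ‖ ≤ a := (hAw.comp h45).norm_le hta
  have hlb : ‖K u‖ ≤ b := (hK _ _ hu').norm_le htb
  have hlc : ‖u‖ ≤ c := hu'.norm_le htc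
  have hlρ : R θ ≤ ρ := le_of_tendsto_of_lowerSemicontinuous hlsc
    (hθ.comp (hφ₂.comp (hφ₃.comp h45)).tendsto_atTop) hρ
  have hlim : Tendsto (fun n => J (z (ψ (φ₄ (φ₅ n))))) atTop
      (𝓝 (ENNReal.ofReal (lam * a ^ α + mu * b ^ β + c ^ γ) + ρ)) := by
    refine (ENNReal.tendsto_ofReal ?_).add hρ
    exact (((hta.rpow_const (Or.inr hα.le)).const_mul lam).add
      ((htb.rpow_const (Or.inr hβ.le)).const_mul mu)).add (htc.rpow_const (Or.inr hγ.le))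
  have hmeq := tendsto_nhds_unique (hzm.comp hψ.tendsto_atTop) hlim
  have hle : J (u, θ) ≤ m := by
    rw [hmeq]
    refine add_le_add (ENNReal.ofReal_le_ofReal ?_) hlρ
    gcongr
  exact ⟨u, θ, hle.trans_lt hmtop, fun v η => hle.trans (hm (v, η))⟩

/-! ### The Nemytskii operator -/

section Path

variable {Q κ X V W : Type*} [MetricSpace Q] [Fintype κ] [MeasurableSpace X] {μ : Measure X}
  [IsFiniteMeasure μ] {s s' p q : ℝ≥0∞} [Fact (1 ≤ s)] [Fact (1 ≤ s')] [Fact (1 ≤ p)]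
  [Fact (1 ≤ q)] [NormedAddCommGroup V] [NormedSpace ℝ V] [NormedAddCommGroup W]
  [NormedSpace ℝ W] {T : ℝ}

theorem exists_bound_path (i : Lp ℝ s' μ →L[ℝ] W) {f : (Q × ℝ) × (κ → ℝ) → ℝ}
    (hf : Continuous f) {M : ℝ} (hM : 0 ≤ M) {S : Set Q} (hS : IsCompact S) :
    ∃ C : ℝ, ∀ θ ∈ S, ∀ t ∈ Ioo 0 T, ∀ v : PiLp s fun _ : κ => Lp ℝ s μ,
      ‖i (superposition s' hf hM ((θ, t), v))‖ ≤ C := by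
  obtain ⟨C, hC⟩ := exists_bound_superposition (s := s) (q := s') (μ := μ) hf hM
    (hS.prod (isCompact_Icc (a := (0 : ℝ)) (b := T)))
  exact ⟨‖i‖ * C, fun θ hθ t ht v => (i.le_opNorm _).trans (mul_le_mul_of_nonneg_left
    (hC _ ⟨hθ, Ioo_subset_Icc_self ht⟩) (norm_nonneg _))⟩

/-- Measurability in time follows from joint continuity of the superposition, composed with a
strongly measurable path. -/
theorem memLp_path (hs' : s' ≠ ⊤) (i : Lp ℝ s' μ →L[ℝ] W) {f : (Q × ℝ) × (κ → ℝ) → ℝ}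
    (hf : Continuous f) {M : ℝ} (hM : 0 ≤ M) (e : V →L[ℝ] PiLp s fun _ : κ => Lp ℝ s μ) (θ : Q)
    (v : Lp V p (volume.restrict (Ioo 0 T))) :
    MemLp (fun t => i (superposition s' hf hM ((θ, t), e (v t)))) q
      (volume.restrict (Ioo 0 T)) := by
  obtain ⟨C, hC⟩ := exists_bound_path (s := s) (T := T) i hf hM (isCompact_singleton (x := θ))
  refine MemLp.of_bound ?_ C ?_
  · have h1 : AEStronglyMeasurable (fun t => ((θ, t), e (v t))) (volume.restrict (Ioo 0 T)) :=
      (by fun_prop : Continuous fun t : ℝ => (θ, t)).aestronglyMeasurable.prodMk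
        (e.continuous.comp_aestronglyMeasurable (Lp.aestronglyMeasurable v))
    exact (i.continuous.comp (continuous_superposition hs' hf hM)).comp_aestronglyMeasurable h1
  · filter_upwards [ae_restrict_mem measurableSet_Ioo] with t ht
    exact hC θ rfl t ht _

theorem tendsto_path (hs' : s' ≠ ⊤) (hq : q ≠ ⊤) (i : Lp ℝ s' μ →L[ℝ] W)
    {f : (Q × ℝ) × (κ → ℝ) → ℝ} (hf : Continuous f) {M : ℝ} (hM : 0 ≤ M)
    (e : V →L[ℝ] PiLp s fun _ : κ => Lp ℝ s μ) {θ : ℕ → Q} {η : Q} (hθ : Tendsto θ atTop (𝓝 η))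
    {v : ℕ → Lp V p (volume.restrict (Ioo 0 T))} {a : Lp V p (volume.restrict (Ioo 0 T))}
    (hv : ∀ᵐ t ∂volume.restrict (Ioo 0 T), Tendsto (fun n => e (v n t)) atTop (𝓝 (e (a t)))) :
    Tendsto (fun n => (memLp_path (q := q) hs' i hf hM e (θ n) (v n)).toLp _) atTop
      (𝓝 ((memLp_path hs' i hf hM e η a).toLp _)) := by
  obtain ⟨C, hC⟩ := exists_bound_path (s := s) (T := T) i hf hM hθ.isCompact_insert_range
  refine tendsto_toLp_of_bounded hq _ _ (C := C) (fun n => ?_) ?_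
  · filter_upwards [ae_restrict_mem measurableSet_Ioo] with t ht
    exact hC _ (mem_insert_of_mem _ ⟨n, rfl⟩) t ht _
  · filter_upwards [hv] with t ht
    exact ((i.continuous.comp (continuous_superposition hs' hf hM)).tendsto _).comp
      ((hθ.prodMk_nhds tendsto_const_nhds).prodMk_nhds ht)

end Path

section Nemytskii

variable {d κ : ℕ} {Ω : Set (EuclideanSpace ℝ (Fin d))} {T : ℝ}
  {s s' p q : ℝ≥0∞} [Fact (1 ≤ s)] [Fact (1 ≤ s')] [Fact (1 ≤ p)] [Fact (1 ≤ q)]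
  {V V' W : Type*} [NormedAddCommGroup V] [NormedSpace ℝ V]
  [NormedAddCommGroup V'] [NormedSpace ℝ V'] [NormedAddCommGroup W] [NormedSpace ℝ W]
  {e : V →L[ℝ] SobolevSpace Ω κ s} {i : Lp ℝ s' (volume.restrict Ω) →L[ℝ] W}
  {ι : V →L[ℝ] V'}

/-- Uniqueness makes the choice in `nemytskii` harmless: any exhibited image, in particular the
truncated one, is its value. -/
theorem IsNemytskii.unique {f : ℝ → (MultiIdx d κ → ℝ) → ℝ} {u : StateSpace ι p T}
    {w w' : Lp W q (volume.restrict (Ioo 0 T))} (h : IsNemytskii e i f u w)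
    (h' : IsNemytskii e i f u w') : w = w' := by
  refine Lp.ext ?_
  filter_upwards [h, h'] with t ht ht'
  obtain ⟨g, hg, hw⟩ := ht
  obtain ⟨g', hg', hw'⟩ := ht'
  rw [hw, hw']
  congr 1
  refine Lp.ext ?_
  filter_upwards [hg, hg'] with x hx hx'
  rw [hx, hx']

theorem IsNemytskii.nemytskii_eq {f : ℝ → (MultiIdx d κ → ℝ) → ℝ} {u : StateSpace ι p T}
    {w : Lp W q (volume.restrict (Ioo 0 T))} (h : IsNemytskii e i f u w) :
    nemytskii e i f u = w := by
  have hex : ∃ w : Lp W q (volume.restrict (Ioo 0 T)), IsNemytskii e i f u w := ⟨w, h⟩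
  rw [nemytskii, dif_pos hex]
  exact hex.choose_spec.unique h

/-- Where the jet is bounded by `M` the truncation is the identity. -/
theorem isNemytskii_path [IsFiniteMeasure (volume.restrict Ω)] (hs' : s' ≠ ⊤) {Q : Type*}
    [MetricSpace Q] {f : (Q × ℝ) × (MultiIdx d κ → ℝ) → ℝ} (hf : Continuous f) {M : ℝ}
    (hM : 0 ≤ M) (θ : Q) {u : StateSpace ι p T}
    (hu : ∀ᵐ t ∂(volume.restrict (Ioo 0 T)), ∀ᵐ x ∂(volume.restrict Ω),
      ∀ β : MultiIdx d κ, |jet e u t x β| ≤ M) :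
    IsNemytskii e i (fun t z => f ((θ, t), z)) u ((memLp_path (q := q) hs' i hf hM
      ((SobolevSpace Ω κ s).subtypeL.comp e) θ (StateSpace.state u)).toLp _) := by
  filter_upwards [hu, (memLp_path (q := q) hs' i hf hM
      ((SobolevSpace Ω κ s).subtypeL.comp e) θ (StateSpace.state u)).coeFn_toLp] with t ht hw
  refine ⟨_, ?_, hw⟩
  filter_upwards [ht, (memLp_superposition (q := s') hf hM ((θ, t),
    (SobolevSpace Ω κ s).subtypeL.comp e (StateSpace.state u t))).coeFn_toLp] with x hx hg
  rw [superposition, hg]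
  congr 2
  exact truncate_eq hx

end Nemytskii

end

/-! ### The existence theorem -/

theorem lemma3p5
    -- the bounded domain, the time horizon, the order of differentiation, the exponents
    {d κ : ℕ} (Ω : Set (EuclideanSpace ℝ (Fin d))) (hΩ : IsOpen Ω)
    (hΩb : Bornology.IsBounded Ω) (T : ℝ) (hT : 0 < T)
    (phat qhat p q r : ℝ≥0∞) [Fact (1 ≤ phat)] [Fact (1 ≤ qhat)] [Fact (1 ≤ p)] [Fact (1 ≤ q)]
    [Fact (1 ≤ r)] (hqphat : qhat ≤ phat) (hphat : phat < ⊤)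
    (hp1 : 1 < p) (hp : p < ⊤) (hqp : q ≤ p) (hr : r < ⊤)
    -- the static spaces
    {V V' W Y : Type*}
    [NormedAddCommGroup V] [NormedSpace ℝ V] [CompleteSpace V]
    [TopologicalSpace.SeparableSpace V] (hV : IsReflexiveSpace V)
    [NormedAddCommGroup V'] [NormedSpace ℝ V'] [CompleteSpace V']
    [TopologicalSpace.SeparableSpace V'] (hV' : IsReflexiveSpace V')
    [NormedAddCommGroup W] [NormedSpace ℝ W] [CompleteSpace W]
    [TopologicalSpace.SeparableSpace W] (hW : IsReflexiveSpace W)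
    [NormedAddCommGroup Y] [NormedSpace ℝ Y] [CompleteSpace Y]
    -- the embeddings of `V` into `V'`, of `V'` into `W`, of `L^qhat(Ω)` into `W`, and the compact
    -- embedding of `V` into the Sobolev space; they identify the same elements
    (ι : V →L[ℝ] V') (hι : Function.Injective ι)
    (j : V' →L[ℝ] W) (hj : Function.Injective j)
    (i : Lp ℝ qhat (volume.restrict Ω) →L[ℝ] W) (hi : Function.Injective i)
    (e : V →L[ℝ] SobolevSpace Ω κ phat) (he : Function.Injective e) (hec : IsCompactOperator e)
    (hcompat : ∀ v : V, SameIn i j (e v) (ι v))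
    -- either the Sobolev space embeds into `V'`, or conversely
    (hemb : (∃ a : SobolevSpace Ω κ phat →L[ℝ] V', Function.Injective a ∧
          ∀ v, SameIn i j v (a v)) ∨
        (∃ b : V' →L[ℝ] SobolevSpace Ω κ phat, Function.Injective b ∧
          ∀ w, SameIn i j (b w) w))
    -- uniform state space regularity
    (hunif : ∃ c : ℝ, 0 < c ∧ ∀ u : StateSpace ι p T,
      ∀ᵐ t ∂(volume.restrict (Ioo 0 T)), ∀ᵐ x ∂(volume.restrict Ω),
        ∀ β : MultiIdx d κ, |jet e u t x β| ≤ c * ‖u‖)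
    -- the network architecture, with continuous activations, and its parameter set
    (A : SymbolicArchitecture) (hA : ∀ l, Continuous (A.act l))
    (coord : Fin (A.actWidth 0) ≃ Option (MultiIdx d κ)) (ε : ℝ) (hε : 0 < ε)
    -- the measurement operators, the data and the weights
    (K : ℕ → StateSpace ι p T → Lp Y r (volume.restrict (Ioo 0 T)))
    (hK : ∀ m, WeakWeakContinuous (K m))
    (y : ℕ → Lp Y r (volume.restrict (Ioo 0 T)))
    (lam mu : ℕ → ℝ) (hlam : ∀ m, 0 < lam m) (hmu : ∀ m, 0 < mu m)
    -- the regularization: proper, coercive, lower semicontinuous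
    (R₀ : A.paramSet ε → ℝ≥0∞) (hproper : ∃ θ, R₀ θ ≠ ⊤)
    (hcoer : Tendsto R₀ (Bornology.cobounded (A.paramSet ε)) (𝓝 ⊤))
    (hlsc : LowerSemicontinuous R₀) :
    -- the network operator is well defined on the state space
    (∀ (θ : A.paramSet ε) (u : StateSpace ι p T),
      IsNemytskii e i (A.law coord θ.1) u
        (nemytskii e i (A.law coord θ.1) u : Lp W q (volume.restrict (Ioo 0 T)))) ∧
    -- for every `m` the problem has a minimizer, and the minimum is finite
    ∀ m : ℕ, ∃ (u : StateSpace ι p T) (θ : A.paramSet ε),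
      objective e i j hqp (lam m) (mu m) (K m) (y m) (A.law coord θ.1) (R₀ θ) u < ⊤ ∧
      ∀ (v : StateSpace ι p T) (η : A.paramSet ε),
        objective e i j hqp (lam m) (mu m) (K m) (y m) (A.law coord θ.1) (R₀ θ) u ≤
          objective e i j hqp (lam m) (mu m) (K m) (y m) (A.law coord η.1) (R₀ η) v := by
  have : IsFiniteMeasure (volume.restrict Ω) := isFiniteMeasure_restrict.2 hΩb.measure_lt_top.ne
  have hqhat : qhat ≠ ⊤ := (hqphat.trans_lt hphat).ne
  have hq : q ≠ ⊤ := (hqp.trans_lt hp).ne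
  obtain ⟨c, hc, hcu⟩ := hunif
  let f : (A.paramSet ε × ℝ) × (MultiIdx d κ → ℝ) → ℝ := fun z => A.law coord z.1.1.1 z.1.2 z.2
  have hf : Continuous f := SymbolicArchitecture.continuous_law coord hA hε
  let e' := (SobolevSpace Ω κ phat).subtypeL.comp e
  -- The level `M` is free above `c * ‖u‖`, so that a single truncation can serve a whole bounded
  -- sequence and its limit.
  have hnem : ∀ (M : ℝ) (hM : 0 ≤ M) (θ : A.paramSet ε) (u : StateSpace ι p T), c * ‖u‖ ≤ M →
      IsNemytskii e i (A.law coord θ.1) u ((memLp_path (q := q) hqhat i hf hM e' θ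
        (StateSpace.state u)).toLp _) := fun M hM θ u huM =>
    isNemytskii_path hqhat hf hM θ ((hcu u).mono fun t ht => ht.mono fun x hx β =>
      (hx β).trans huM)
  refine ⟨fun θ u => ?_, fun m => ?_⟩
  · have h := hnem (c * ‖u‖) (by positivity) θ u le_rfl
    rwa [h.nemytskii_eq]
  have := hV.separableSpace_dual
  obtain ⟨c₀, hc₀⟩ := exists_norm_le_of_sameIn (κ := κ) hΩb hqphat i j
  have : ProperSpace (A.paramSet ε) :=
    .of_isClosed (A.isClosed_paramSet ε)
  have hpos : ∀ {a : ℝ≥0∞}, 1 ≤ a → a ≠ ⊤ → 0 < a.toReal := fun h1 h2 =>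
    ENNReal.toReal_pos (zero_lt_one.trans_le h1).ne' h2
  refine exists_minimizer (weaklySeqCompact_stateSpace hV hV' hp1 hp.ne ι) hproper hcoer hlsc
    (A := fun u θ => StateSpace.timeDerivIn j hqp u - nemytskii e i (A.law coord θ.1) u)
    (K := fun u => K m u - y m) ?_ ?_ (hlam m) (hmu m) (hpos Fact.out hq) (hpos Fact.out hr.ne)
    (hpos hp1.le hp.ne)
  · intro u a θ η hu hθ
    obtain ⟨φ, hφ, hae⟩ := exists_subseq_ae_tendsto_of_weaklyTendsto
      hT hV.weaklySeqCompact hι hj hec (fun v => hc₀ (e v) (ι v) (hcompat v))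
      (fun n => StateSpace.hasWeakDeriv j (u n - a)) hu.state hu.timeDeriv
    refine ⟨φ, hφ, ?_⟩
    obtain ⟨B, hB⟩ := hu.bounded
    let M := c * max B ‖a‖
    have hM : 0 ≤ M := mul_nonneg hc.le ((norm_nonneg a).trans (le_max_right _ _))
    have h1 : ∀ n, nemytskii e i (A.law coord (θ (φ n)).1) (u (φ n)) = (memLp_path (q := q) hqhat i
        hf hM e' (θ (φ n)) (StateSpace.state (u (φ n)))).toLp _ := fun n =>
      (hnem M hM _ _ (mul_le_mul_of_nonneg_left ((hB _).trans (le_max_left _ _))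
        hc.le)).nemytskii_eq
    have h2 : nemytskii e i (A.law coord η.1) a = (memLp_path (q := q) hqhat i hf hM e' η
        (StateSpace.state a)).toLp _ :=
      (hnem M hM _ _ (mul_le_mul_of_nonneg_left (le_max_right _ _) hc.le)).nemytskii_eq
    simp only [h1, h2]
    -- The derivative part converges weakly, the network part in norm.
    refine ((hu.comp hφ).timeDerivIn j hqp).sub (weaklyTendsto_of_tendsto ?_)
    refine tendsto_path hqhat hq i hf hM e' (hθ.comp hφ.tendsto_atTop) ?_
    filter_upwards [hae] with t ht
    exact (continuous_subtype_val.tendsto _).comp ht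
  · intro x a hx
    exact (hK m x a hx).sub (weaklyTendsto_of_tendsto tendsto_const_nhds)
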